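/- Let $s\ge 1$ be an integer, let $\boldsymbol u=(u_1,\dots,u_s)$ with all $u_j>0$, and put $g(\boldsymbol x)=\exp\bigl(-\sum_{j=1}^s u_jx_j\bigr)$. **Notation.** A *digital net over $\mathbb B=\{0,1\}=\mathbb F_2$* in dimension $s$ is a finite set $P=\{\boldsymbol x_0,\dots,\boldsymbol x_{2^m-1}\}\subset[0,1)^s$ obtained from integers $n\ge m\ge1$ and matrices $C_1,\dots,C_s\in\mathbb F_2^{n\times m}$ as follows: for $0\le h<2^m$ with binary expansion $h=\sum_{i=1}^m h_i2^{i-1}$, the $j$-th coordinate of $\boldsymbol x_h$ is $\sum_{i=1}^n y_i2^{-i}$, where $(y_1,\dots,y_n)^\top=C_j(h_1,\dots,h_m)^\top$ over $\mathbb F_2$ and the $y_i$ are read as elements of $\{0,1\}\subset\mathbb Z$. For a finite nonempty set $P\subset[0,1)^s$ let $$\mathrm{Err}(f;P)=\frac1{|P|}\sum_{\boldsymbol x\in P}f(\boldsymbol x)-\int_{[0,1)^s}f(\boldsymbol x)\,d\boldsymbol x .$$ Let $$\mathcal F_{s,\boldsymbol u}=\Bigl\{f\in C^\infty([0,1]^s)\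 \Big|\ \|f\|:=\sup_{\alpha\in\mathbb N_0^s}\frac{\|f^{(\alpha_1,\dots,\alpha_s)}\|_{L^1([0,1]^s)}}{\prod_{j=1}^s u_j^{\alpha_j}}<\infty\Bigr\},$$ where $f^{(\alpha_1,\dots,\alpha_s)}$ is the mixed partial derivative, and let the worst-case error be $$e^{\mathrm{wor}}(P,\mathcal F_{s,\boldsymbol u})=\sup\bigl\{|\mathrm{Err}(f;P)| : f\in\mathcal F_{s,\boldsymbol u},\ \|f\|\le1\bigr\}.$$ Finally let $$A=\prod_{j=1}^s\frac{1-e^{-u_j}}{u_j},\qquad B=\prod_{j=1}^s\ \inf_{w\in\mathbb N,\ w\ge1}\Bigl(\frac{1-e^{-2^{-w}u_j}}{2^{-w}u_j}\prod_{i=1}^{w}\frac{1-e^{-2^{-i}u_j}}{2^{-i}u_j}\Bigr).$$ **Theorem.** One has $B>0$, $g\in\mathcal F_{s,\boldsymbol u}$ and $\|g\|>0$. For every digital net $P$ over $\mathbb B$ in dimension $s$, $$A^{-1}\,\mathrm{Err}(g;P)\ \le\ e^{\mathrm{wor}}(P,\mathcal F_{s,\boldsymbol u})\ \le\ 2^sB^{-1}\,\mathrm{Err}(g;P),$$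 and, with the normalized function $\tilde g=g/\|g\|$, $$\mathrm{Err}(\tilde g;P)\ \le\ e^{\mathrm{wor}}(P,\mathcal F_{s,\boldsymbol u})\ \le\ \frac{2^sA}{B}\,\mathrm{Err}(\tilde g;P).$$ Moreover $\mathrm{Err}(g;P)>0$ for every digital net $P$. -/

import Mathlib

open MeasureTheory
open scoped ContDiff

noncomputable section

namespace QMC

/-- The closed unit cube `[0,1]^s`. -/
def closedCube (s : ℕ) : Set (Fin s → ℝ) := Set.Icc 0 1

/-- The half-open unit cube `[0,1)^s`. -/
def halfOpenCube (s : ℕ) : Set (Fin s → ℝ) := Set.univ.pi fun _ => Set.Ico (0 : ℝ) 1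

/-- The integral `I(f)` of `f` over `[0,1)^s`. -/
def integral {s : ℕ} (f : (Fin s → ℝ) → ℝ) : ℝ := ∫ x in halfOpenCube s, f x

/-- The quadrature rule `I_P(f) = (1/N) ∑_{x ∈ P} f(x)`, where `N` is the cardinality of `P`. -/
def quadrature {s : ℕ} (P : Finset (Fin s → ℝ)) (f : (Fin s → ℝ) → ℝ) : ℝ :=
  (1 / (P.card : ℝ)) * ∑ x ∈ P, f x

/-- The signed integration error `Err(f;P) = I_P(f) - I(f)`. -/
def err {s : ℕ} (f : (Fin s → ℝ) → ℝ) (P : Finset (Fin s → ℝ)) : ℝ :=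
  quadrature P f - integral f

/-- The vector `(h_1, …, h_m)` of binary digits of `h = ∑ h_i 2^(i-1)`, over the two-element field.
The index `i : Fin m` stands for the digit `h_{i+1}`. -/
def digitVector (m h : ℕ) : Fin m → ZMod 2 := fun i => if h.testBit i then 1 else 0

/-- The point `x_h` of the digital net with generating matrices `C_1, …, C_s`: its `j`-th coordinate
is `∑_{1 ≤ i ≤ n} y_i 2^(-i)` with `y = C_j (h_1, …, h_m)ᵀ`, the digits being read in `{0,1}`.
The index `i : Fin n` stands for the digit `y_{i+1}`. -/
def digitalNetPoint {s n m : ℕ} (C : Fin s → Matrix (Fin n) (Fin m) (ZMod 2)) (h : ℕ) :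
    Fin s → ℝ :=
  fun j => ∑ i : Fin n, (((C j).mulVec (digitVector m h) i).val : ℝ) / 2 ^ ((i : ℕ) + 1)

/-- `P` is a digital net over the two-element field in dimension `s`. -/
def IsDigitalNet {s : ℕ} (P : Finset (Fin s → ℝ)) : Prop :=
  ∃ (n m : ℕ) (C : Fin s → Matrix (Fin n) (Fin m) (ZMod 2)), 1 ≤ m ∧ m ≤ n ∧
    (P : Set (Fin s → ℝ)) = {x | ∃ h : ℕ, h < 2 ^ m ∧ x = digitalNetPoint C h}

/-- The partial derivative in the `j`-th variable of a function on `[0,1]^s`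
(one-sided where the `j`-th coordinate is `0` or `1`). -/
def partialDeriv {s : ℕ} (j : Fin s) (f : (Fin s → ℝ) → ℝ) : (Fin s → ℝ) → ℝ :=
  fun x => derivWithin (fun t => f (Function.update x j t)) (Set.Icc (0 : ℝ) 1) (x j)

/-- The mixed partial derivative `f^(α_1, …, α_s)`. -/
def mixedDeriv {s : ℕ} (α : Fin s → ℕ) (f : (Fin s → ℝ) → ℝ) : (Fin s → ℝ) → ℝ :=
  (List.finRange s).foldr (fun j h => (partialDeriv j)^[α j] h) f

/-- The `L^1` norm on `[0,1]^s`. -/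
def normL1 {s : ℕ} (f : (Fin s → ℝ) → ℝ) : ℝ := ∫ x in closedCube s, |f x|

/-- The quotient `‖f^(α)‖_{L^1} / ∏_j u_j^{α_j}`. -/
def weightedDerivNorm {s : ℕ} (u : Fin s → ℝ) (f : (Fin s → ℝ) → ℝ) (α : Fin s → ℕ) : ℝ :=
  normL1 (mixedDeriv α f) / ∏ j, u j ^ α j

/-- The space `F_{s,u}`: the smooth functions on `[0,1]^s` for which the supremum that defines
the norm is finite. Functions are total functions on `ℝ^s`; only their values on the closed cube
matter. -/
def weightedSpace {s : ℕ} (u : Fin s → ℝ) : Set ((Fin s → ℝ) → ℝ) :=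
  {f | ContDiffOn ℝ ∞ f (closedCube s) ∧ BddAbove (Set.range (weightedDerivNorm u f))}

/-- The norm of `F_{s,u}`, `sup_α ‖f^(α)‖_{L^1} / ∏_j u_j^{α_j}`. -/
def weightedNorm {s : ℕ} (u : Fin s → ℝ) (f : (Fin s → ℝ) → ℝ) : ℝ :=
  ⨆ α : Fin s → ℕ, weightedDerivNorm u f α

/-- The worst-case error `sup {|Err(f;P)| : f ∈ F_{s,u}, ‖f‖ ≤ 1}`, an extended real number, so
that a real upper bound for it includes its finiteness. -/
def worstCaseError {s : ℕ} (P : Finset (Fin s → ℝ)) (u : Fin s → ℝ) : EReal :=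
  sSup {e : EReal | ∃ f ∈ weightedSpace u, weightedNorm u f ≤ 1 ∧ e = ((|err f P| : ℝ) : EReal)}

/-- The function `g_{s,u}(x) = exp(-∑_j u_j x_j)`. -/
def expFun {s : ℕ} (u : Fin s → ℝ) : (Fin s → ℝ) → ℝ := fun x => Real.exp (-∑ j, u j * x j)

/-- The normalized function `g_{s,u} / ‖g_{s,u}‖`. -/
def normalizedExpFun {s : ℕ} (u : Fin s → ℝ) : (Fin s → ℝ) → ℝ :=
  fun x => expFun u x / weightedNorm u (expFun u)

/-- The constant `A_{s,u}`. -/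
def constA {s : ℕ} (u : Fin s → ℝ) : ℝ := ∏ j, (1 - Real.exp (-u j)) / u j

/-- The constant `B_{s,u}`; the infimum is over the integers `w ≥ 1`. -/
def constB {s : ℕ} (u : Fin s → ℝ) : ℝ :=
  ∏ j, ⨅ w : Set.Ici (1 : ℕ),
    ((1 - Real.exp (-(u j / 2 ^ (w : ℕ)))) / (u j / 2 ^ (w : ℕ)) *
      ∏ i ∈ Finset.Icc 1 (w : ℕ), (1 - Real.exp (-(u j / 2 ^ i))) / (u j / 2 ^ i))

end QMC

end

/-! Expand everything in Walsh functions. A digital net is the image of a subgroup of digit arrays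
on which Walsh functions are characters, so the net average of each Walsh function is nonnegative
(`sum_walshProd_nonneg`). The error of `f` is thus a combination of its nonconstant Walsh
coefficients with nonnegative weights, and it suffices to dominate each coefficient of `f` by the
corresponding one of the exponential `g`.

Two estimates do this. Splitting the interval into halves, `le_expWalshCoeff` bounds the
coefficients of the exponential from below by a product of powers of `u`, the digit weight, and a
factor at least that of `B`. Integrating by parts once for every nonzero digit,
`exists_walsh_kernel` and `abs_walshCoeff_le_normL1` bound a coefficient of `f` by the L¹ norm of a
mixed derivative times the same digit weight, with a loss of 2 per coordinate. The quotient of the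
bounds is `2 ^ s / B` (`abs_walshCoeff_le_expFun`).

Convergence of Walsh series is not needed: partial sums of depth `L` are averages over dyadic boxes,
which converge at each point of the net by continuity. The comparison is made at finite depth and
passed to the limit in `abs_err_le`.

For the lower bound, every weighted derivative of `g` has the same L¹ norm `A`, so `g / A` is itself
an admissible test function. Strict positivity holds because the net has only finitely many digits:
a Rademacher function beyond them equals 1 on the whole net, while its coefficient for `g` is
positive. -/

noncomputable section

namespace QMC

/-! ### Integration over the unit interval. -/

/-- Lebesgue measure on `[0,1)`. -/
abbrev unitVol : Measure ℝ := volume.restrict (Set.Ico 0 1)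

instance : IsProbabilityMeasure unitVol := ⟨by simp [unitVol]⟩

lemma integral_unitVol_congr {F G : ℝ → ℝ} (h : ∀ t ∈ Set.Ico (0 : ℝ) 1, F t = G t) :
    ∫ t, F t ∂unitVol = ∫ t, G t ∂unitVol :=
  setIntegral_congr_fun measurableSet_Ico h

lemma integral_unitVol_eq_intervalIntegral (F : ℝ → ℝ) :
    ∫ t, F t ∂unitVol = ∫ t in (0 : ℝ)..1, F t := by
  rw [intervalIntegral.integral_of_le zero_le_one, integral_Ico_eq_integral_Ioc]

lemma integrable_unitVol_of_continuousOn {F : ℝ → ℝ} (h : ContinuousOn F (Set.Icc 0 1)) :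
    Integrable F unitVol :=
  (h.integrableOn_Icc).mono_set Set.Ico_subset_Icc_self

lemma integrable_unitVol_continuousOn_mul {F b : ℝ → ℝ} {c : ℝ}
    (h : ContinuousOn F (Set.Icc 0 1)) (hb : Measurable b) (hc : ∀ t, |b t| ≤ c) :
    Integrable (fun t => F t * b t) unitVol :=
  (integrable_unitVol_of_continuousOn h).mul_bdd (c := c) hb.aestronglyMeasurable
    (Filter.Eventually.of_forall hc)

lemma integrable_unitVol_of_bounded {b : ℝ → ℝ} {c : ℝ}
    (hb : Measurable b) (hc : ∀ t, |b t| ≤ c) : Integrable b unitVol := by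
  simpa using integrable_unitVol_continuousOn_mul (F := fun _ => 1) continuousOn_const hb hc

/-- Splitting an integral over the unit interval into its two halves. -/
lemma integral_unitVol_halves {F : ℝ → ℝ} (h : Integrable F unitVol) :
    ∫ t, F t ∂unitVol =
      (1 / 2) * ∫ y, F (y / 2) ∂unitVol + (1 / 2) * ∫ y, F (y / 2 + 1 / 2) ∂unitVol := by
  have h01 : IntervalIntegrable F volume 0 1 := by
    rw [intervalIntegrable_iff_integrableOn_Ico_of_le zero_le_one]
    exact h
  simp only [integral_unitVol_eq_intervalIntegral]
  rw [intervalIntegral.integral_comp_div _ two_ne_zero,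
    intervalIntegral.integral_comp_div_add _ two_ne_zero,
    ← intervalIntegral.integral_add_adjacent_intervals (a := 0) (b := 1 / 2) (c := 1)]
  · norm_num
    ring
  · exact h01.mono_set (by
      rw [Set.uIcc_of_le (by norm_num), Set.uIcc_of_le (by norm_num)]
      exact Set.Icc_subset_Icc_right (by norm_num))
  · exact h01.mono_set (by
      rw [Set.uIcc_of_le (by norm_num), Set.uIcc_of_le (by norm_num)]
      exact Set.Icc_subset_Icc_left (by norm_num))

/-! ### Rademacher and Walsh functions, and their behaviour under halving. -/

/-- The Rademacher function: the sign attached to the binary digit of `t` of weight `2^(-(i+1))`. -/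
def rademacher (i : ℕ) (t : ℝ) : ℝ := if Even ⌊2 ^ (i + 1) * t⌋ then 1 else -1

lemma rademacher_add_intCast (i : ℕ) (t : ℝ) (z : ℤ) : rademacher i (t + z) = rademacher i t := by
  have h : ⌊(2 : ℝ) ^ (i + 1) * (t + z)⌋ = ⌊(2 : ℝ) ^ (i + 1) * t⌋ + 2 ^ (i + 1) * z := by
    rw [← Int.floor_add_intCast]
    push_cast
    ring_nf
  have h2 : Even ((2 : ℤ) ^ (i + 1) * z) := by
    rw [pow_succ]
    exact ⟨2 ^ i * z, by ring⟩
  simp only [rademacher, h, Int.even_add, h2, iff_true]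

lemma rademacher_succ (i : ℕ) (t : ℝ) : rademacher (i + 1) t = rademacher i (2 * t) := by
  simp only [rademacher]
  rw [show (2 : ℝ) ^ (i + 1 + 1) * t = 2 ^ (i + 1) * (2 * t) by ring]

lemma rademacher_succ_half (i : ℕ) (y : ℝ) : rademacher (i + 1) (y / 2) = rademacher i y := by
  rw [rademacher_succ, mul_div_cancel₀ _ two_ne_zero]

lemma rademacher_succ_half_add (i : ℕ) (y : ℝ) :
    rademacher (i + 1) (y / 2 + 1 / 2) = rademacher i y := by
  rw [rademacher_succ, show 2 * (y / 2 + 1 / 2) = y + ((1 : ℤ) : ℝ) by push_cast; ring,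
    rademacher_add_intCast]

lemma rademacher_zero_half {y : ℝ} (hy : y ∈ Set.Ico (0 : ℝ) 1) : rademacher 0 (y / 2) = 1 := by
  have : ⌊(2 : ℝ) ^ (0 + 1) * (y / 2)⌋ = 0 := by
    rw [Int.floor_eq_iff]
    constructor <;> push_cast <;> linarith [hy.1, hy.2]
  simp only [rademacher, this]
  rw [if_pos (by decide)]

lemma rademacher_zero_half_add {y : ℝ} (hy : y ∈ Set.Ico (0 : ℝ) 1) :
    rademacher 0 (y / 2 + 1 / 2) = -1 := by
  have : ⌊(2 : ℝ) ^ (0 + 1) * (y / 2 + 1 / 2)⌋ = 1 := by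
    rw [Int.floor_eq_iff]
    constructor <;> push_cast <;> linarith [hy.1, hy.2]
  simp only [rademacher, this]
  rw [if_neg (by decide)]

lemma measurable_rademacher (i : ℕ) : Measurable (rademacher i) := by
  have : Measurable fun t : ℝ => ⌊(2 : ℝ) ^ (i + 1) * t⌋ :=
    Int.measurable_floor.comp (measurable_const_mul _)
  exact Measurable.ite (this (MeasurableSet.of_discrete (s := {z : ℤ | Even z})))
    measurable_const measurable_const

lemma rademacher_eq_or (i : ℕ) (t : ℝ) : rademacher i t = 1 ∨ rademacher i t = -1 := by
  simp only [rademacher]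
  split_ifs <;> simp

/-- The Walsh function of depth `L` with digit set `k`. -/
def walsh {L : ℕ} (k : Fin L → Bool) (t : ℝ) : ℝ := ∏ i, if k i then rademacher i t else 1

lemma measurable_walsh {L : ℕ} (k : Fin L → Bool) : Measurable (walsh k) := by
  refine Finset.measurable_prod _ fun i _ => ?_
  cases k i
  · simp
  · simpa using measurable_rademacher i

lemma abs_walsh {L : ℕ} (k : Fin L → Bool) (t : ℝ) : |walsh k t| = 1 := by
  rw [walsh, Finset.abs_prod]
  refine Finset.prod_eq_one fun i _ => ?_
  rcases rademacher_eq_or i t with h | h <;> cases k i <;> simp [h]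

lemma walsh_half {L : ℕ} (k : Fin (L + 1) → Bool) {y : ℝ} (hy : y ∈ Set.Ico (0 : ℝ) 1) :
    walsh k (y / 2) = walsh (Fin.tail k) y := by
  simp only [walsh, Fin.prod_univ_succ, Fin.val_zero, Fin.val_succ, rademacher_succ_half,
    rademacher_zero_half hy, ite_self, one_mul, Fin.tail]
  rfl

lemma walsh_half_add {L : ℕ} (k : Fin (L + 1) → Bool) {y : ℝ} (hy : y ∈ Set.Ico (0 : ℝ) 1) :
    walsh k (y / 2 + 1 / 2) = (if k 0 then -1 else 1) * walsh (Fin.tail k) y := by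
  simp only [walsh, Fin.prod_univ_succ, Fin.val_zero, Fin.val_succ, rademacher_succ_half_add,
    rademacher_zero_half_add hy, Fin.tail]
  rfl

/-- The number of nonzero digits. -/
def digitCount : {L : ℕ} → (Fin L → Bool) → ℕ
  | 0, _ => 0
  | _ + 1, k => digitCount (Fin.tail k) + if k 0 then 1 else 0

/-- The product of `2^(-i-1)` over the positions `i ≥ 1` of the nonzero digits. -/
def digitWeight : {L : ℕ} → (Fin L → Bool) → ℝ
  | 0, _ => 1
  | _ + 1, k => (if k 0 then 1 / 4 else 1) * (1 / 2) ^ digitCount (Fin.tail k) *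
      digitWeight (Fin.tail k)

lemma digitWeight_pos {L : ℕ} (k : Fin L → Bool) : 0 < digitWeight k := by
  induction L with
  | zero => exact one_pos
  | succ L ih =>
    have := ih (Fin.tail k)
    rw [digitWeight]
    split_ifs <;> positivity

/-! ### The Walsh-Dirichlet kernel. -/

/-- The Dirichlet kernel `∑_k walsh k x * walsh k y` of depth `L`. -/
def dirichletKernel (L : ℕ) (x y : ℝ) : ℝ :=
  ∏ i : Fin L, (1 + rademacher i x * rademacher i y)

lemma dirichletKernel_eq_sum (L : ℕ) (x y : ℝ) :
    dirichletKernel L x y = ∑ k : Fin L → Bool, walsh k x * walsh k y := by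
  have h (i : Fin L) : 1 + rademacher i x * rademacher i y =
      ∑ b : Bool, (if b then rademacher i x else 1) * (if b then rademacher i y else 1) := by
    simp [add_comm]
  simp only [dirichletKernel, h, Finset.prod_univ_sum, Fintype.piFinset_univ, walsh,
    Finset.prod_mul_distrib]

lemma dirichletKernel_nonneg (L : ℕ) (x y : ℝ) : 0 ≤ dirichletKernel L x y := by
  refine Finset.prod_nonneg fun i _ => ?_
  rcases rademacher_eq_or i x with h | h <;> rcases rademacher_eq_or i y with h' | h' <;>
    simp [h, h']

lemma measurable_dirichletKernel (L : ℕ) (y : ℝ) : Measurable fun x => dirichletKernel L x y :=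
  Finset.measurable_prod _ fun i _ => ((measurable_rademacher i).mul_const _).const_add _

/-- The two halves of the interval contribute the factors `1 + c 0` and `1 - c 0`, whose average is
1. The coefficients are arbitrary so that the induction can shift them. -/
lemma integral_prod_one_add_rademacher (L : ℕ) (c : ℕ → ℝ) :
    ∫ x, ∏ i : Fin L, (1 + rademacher i x * c i) ∂unitVol = 1 := by
  induction L generalizing c with
  | zero => simp
  | succ L ih =>
    have hint : Integrable (fun x => ∏ i : Fin (L + 1), (1 + rademacher i x * c i)) unitVol := by
      refine integrable_unitVol_of_bounded (c := ∏ i : Fin (L + 1), (1 + |c i|))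
        (Finset.measurable_prod _ fun i _ => ((measurable_rademacher i).mul_const _).const_add _)
        fun t => ?_
      rw [Finset.abs_prod]
      refine Finset.prod_le_prod (fun _ _ => abs_nonneg _) fun i _ => ?_
      refine (abs_add_le _ _).trans ?_
      rcases rademacher_eq_or i t with h | h <;> simp [h]
    rw [integral_unitVol_halves hint]
    have h1 : ∫ y, ∏ i : Fin (L + 1), (1 + rademacher i (y / 2) * c i) ∂unitVol
        = (1 + c 0) * ∫ y, ∏ i : Fin L, (1 + rademacher i y * c (i + 1)) ∂unitVol := by
      rw [← integral_const_mul]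
      refine integral_unitVol_congr fun y hy => ?_
      simp only [Fin.prod_univ_succ, Fin.val_zero, Fin.val_succ, rademacher_succ_half,
        rademacher_zero_half hy, one_mul]
    have h2 : ∫ y, ∏ i : Fin (L + 1), (1 + rademacher i (y / 2 + 1 / 2) * c i) ∂unitVol
        = (1 - c 0) * ∫ y, ∏ i : Fin L, (1 + rademacher i y * c (i + 1)) ∂unitVol := by
      rw [← integral_const_mul]
      refine integral_unitVol_congr fun y hy => ?_
      simp only [Fin.prod_univ_succ, Fin.val_zero, Fin.val_succ, rademacher_succ_half_add,
        rademacher_zero_half_add hy, neg_one_mul, ← sub_eq_add_neg]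
    rw [h1, h2, ih fun i => c (i + 1)]
    ring

lemma integral_dirichletKernel (L : ℕ) (y : ℝ) : ∫ x, dirichletKernel L x y ∂unitVol = 1 :=
  integral_prod_one_add_rademacher L fun i => rademacher i y

lemma exists_half_of_mem_Ico {x : ℝ} (hx : x ∈ Set.Ico (0 : ℝ) 1) :
    (∃ y ∈ Set.Ico (0 : ℝ) 1, x = y / 2) ∨ ∃ y ∈ Set.Ico (0 : ℝ) 1, x = y / 2 + 1 / 2 := by
  rcases lt_or_ge x (1 / 2) with h | h
  · exact .inl ⟨2 * x, ⟨by linarith [hx.1], by linarith⟩, by ring⟩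
  · exact .inr ⟨2 * x - 1, ⟨by linarith, by linarith [hx.2]⟩, by ring⟩

/-- A factor of the kernel vanishes as soon as two digits differ, so a nonzero kernel puts both
points in one dyadic interval of depth `L`. -/
lemma abs_sub_le_of_dirichletKernel_ne_zero {L : ℕ} {x y : ℝ} (hx : x ∈ Set.Ico (0 : ℝ) 1)
    (hy : y ∈ Set.Ico (0 : ℝ) 1) (h : dirichletKernel L x y ≠ 0) : |x - y| ≤ (1 / 2) ^ L := by
  induction L generalizing x y with
  | zero => rw [pow_zero, abs_le]; constructor <;> linarith [hx.1, hx.2, hy.1, hy.2]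
  | succ L ih =>
    obtain ⟨x', hx', rfl | rfl⟩ : ∃ x' ∈ Set.Ico (0 : ℝ) 1, x = x' / 2 ∨ x = x' / 2 + 1 / 2 := by
      rcases exists_half_of_mem_Ico hx with ⟨z, hz, e⟩ | ⟨z, hz, e⟩
      exacts [⟨z, hz, .inl e⟩, ⟨z, hz, .inr e⟩]
    all_goals
      obtain ⟨y', hy', rfl | rfl⟩ : ∃ y' ∈ Set.Ico (0 : ℝ) 1, y = y' / 2 ∨ y = y' / 2 + 1 / 2 := by
        rcases exists_half_of_mem_Ico hy with ⟨z, hz, e⟩ | ⟨z, hz, e⟩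
        exacts [⟨z, hz, .inl e⟩, ⟨z, hz, .inr e⟩]
    all_goals
      simp only [dirichletKernel, Fin.prod_univ_succ, Fin.val_zero, Fin.val_succ,
        rademacher_succ_half, rademacher_succ_half_add, rademacher_zero_half hx',
        rademacher_zero_half hy', rademacher_zero_half_add hx', rademacher_zero_half_add hy'] at h
    · have := ih hx' hy' (right_ne_zero_of_mul h)
      rw [show x' / 2 - y' / 2 = (x' - y') * (1 / 2) by ring, abs_mul, pow_succ]
      norm_num
      norm_num at this
      linarith
    -- The points lie in different halves, so the leading factor is `1 - 1`.
    · norm_num at h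
    · norm_num at h
    · have := ih hx' hy' (right_ne_zero_of_mul h)
      rw [show x' / 2 + 1 / 2 - (y' / 2 + 1 / 2) = (x' - y') * (1 / 2) by ring, abs_mul, pow_succ]
      norm_num
      norm_num at this
      linarith

/-! ### Means of exponentials and the constants `A` and `B`. -/

/-- The mean `(1 - e^(-v)) / v` of `exp(-v t)` over the unit interval. -/
def expMean (v : ℝ) : ℝ := (1 - Real.exp (-v)) / v

lemma integral_exp_neg_mul {v : ℝ} (hv : 0 < v) :
    ∫ t, Real.exp (-(v * t)) ∂unitVol = expMean v := by
  rw [integral_unitVol_eq_intervalIntegral]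
  have := intervalIntegral.integral_comp_mul_left (a := 0) (b := 1) Real.exp (neg_ne_zero.2 hv.ne')
  simp only [neg_mul] at this
  rw [this, integral_exp, expMean]
  simp
  field_simp
  ring

lemma exp_neg_le_expMean {v : ℝ} (hv : 0 < v) : Real.exp (-v) ≤ expMean v := by
  rw [expMean, le_div_iff₀ hv]
  have h1 := Real.add_one_le_exp v
  have h2 : Real.exp (-v) * Real.exp v = 1 := by rw [← Real.exp_add]; simp
  nlinarith [Real.exp_pos (-v)]

lemma expMean_pos {v : ℝ} (hv : 0 < v) : 0 < expMean v :=
  (Real.exp_pos _).trans_le (exp_neg_le_expMean hv)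

/-- The trapezoidal rule overestimates the integral of a convex function. -/
lemma expMean_le {v : ℝ} (hv : 0 < v) : expMean v ≤ (1 + Real.exp (-v)) / 2 := by
  have h2 : ∫ t, ((1 - t) * 1 + t * Real.exp (-v)) ∂unitVol = (1 + Real.exp (-v)) / 2 := by
    rw [integral_unitVol_eq_intervalIntegral, intervalIntegral.integral_add,
      intervalIntegral.integral_mul_const, intervalIntegral.integral_mul_const,
      intervalIntegral.integral_sub]
    · simp
      ring
    all_goals exact Continuous.intervalIntegrable (by fun_prop) _ _
  rw [← integral_exp_neg_mul hv, ← h2]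
  refine setIntegral_mono_on ?_ ?_ measurableSet_Ico fun t ht => ?_
  · exact integrable_unitVol_of_continuousOn (by fun_prop)
  · exact integrable_unitVol_of_continuousOn (by fun_prop)
  · have := convexOn_exp.2 (Set.mem_univ 0) (Set.mem_univ (-v)) (sub_nonneg.2 ht.2.le) ht.1
      (by ring)
    simp only [smul_eq_mul, mul_zero, zero_add, Real.exp_zero] at this
    rwa [mul_neg, mul_comm t v] at this

/-- The expression whose infimum over the depth `L ≥ 1` is a factor of `constB`. -/
def depthFactor (L : ℕ) (u : ℝ) : ℝ :=
  expMean (u / 2 ^ L) * ∏ i ∈ Finset.Icc 1 L, expMean (u / 2 ^ i)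

lemma depthFactor_zero (u : ℝ) : depthFactor 0 u = expMean u := by simp [depthFactor]

lemma depthFactor_succ (L : ℕ) (u : ℝ) :
    depthFactor (L + 1) u = expMean (u / 2) * depthFactor L (u / 2) := by
  have h (L : ℕ) (u : ℝ) : ∏ i ∈ Finset.Icc 1 L, expMean (u / 2 ^ i) =
      ∏ i ∈ Finset.range L, expMean (u / 2 ^ (i + 1)) := by
    rw [← Finset.Ico_add_one_right_eq_Icc, Finset.prod_Ico_eq_prod_range]
    simp [add_comm]
  have h2 (i : ℕ) : u / 2 / 2 ^ i = u / 2 ^ (i + 1) := by rw [pow_succ', div_div]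
  rw [depthFactor, depthFactor, h, h, Finset.prod_range_succ']
  simp only [h2, zero_add, pow_one]
  ring

/-- Each mean is at least the final value of its exponential, and the exponents `u/2 + u/4 + ... +
u/2^L + u/2^L` add up to `u`. The bound does not depend on the depth, which is what makes the
infimum in `B` positive. -/
lemma exp_neg_le_depthFactor (L : ℕ) {u : ℝ} (hu : 0 < u) :
    Real.exp (-u) ≤ depthFactor L u := by
  induction L generalizing u with
  | zero => rw [depthFactor_zero]; exact exp_neg_le_expMean hu
  | succ L ih =>
    rw [depthFactor_succ]
    have h : Real.exp (-u) = Real.exp (-(u / 2)) * Real.exp (-(u / 2)) := by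
      rw [← Real.exp_add]; ring_nf
    rw [h]
    exact mul_le_mul (exp_neg_le_expMean (half_pos hu)) (ih (half_pos hu)) (Real.exp_pos _).le
      (expMean_pos (half_pos hu)).le

lemma depthFactor_pos (L : ℕ) {u : ℝ} (hu : 0 < u) : 0 < depthFactor L u :=
  (Real.exp_pos _).trans_le (exp_neg_le_depthFactor L hu)

/-- The one-dimensional factor of `constB`. -/
def depthInf (u : ℝ) : ℝ := ⨅ w : Set.Ici (1 : ℕ), depthFactor w u

lemma constB_eq {s : ℕ} (u : Fin s → ℝ) : constB u = ∏ j, depthInf (u j) := rfl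

lemma constA_eq {s : ℕ} (u : Fin s → ℝ) : constA u = ∏ j, expMean (u j) := rfl

lemma depthInf_pos {u : ℝ} (hu : 0 < u) : 0 < depthInf u :=
  haveI : Nonempty (Set.Ici (1 : ℕ)) := ⟨⟨1, Set.mem_Ici.2 le_rfl⟩⟩
  (Real.exp_pos _).trans_le (le_ciInf fun w => exp_neg_le_depthFactor w hu)

lemma depthInf_le {L : ℕ} (hL : 1 ≤ L) {u : ℝ} (hu : 0 < u) : depthInf u ≤ depthFactor L u :=
  ciInf_le (f := fun w : Set.Ici (1 : ℕ) => depthFactor w u)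
    ⟨0, by rintro _ ⟨w, rfl⟩; exact (depthFactor_pos w hu).le⟩ ⟨L, hL⟩

lemma constB_pos {s : ℕ} {u : Fin s → ℝ} (hu : ∀ j, 0 < u j) : 0 < constB u := by
  rw [constB_eq]
  exact Finset.prod_pos fun j _ => depthInf_pos (hu j)

lemma constA_pos {s : ℕ} {u : Fin s → ℝ} (hu : ∀ j, 0 < u j) : 0 < constA u := by
  rw [constA_eq]
  exact Finset.prod_pos fun j _ => expMean_pos (hu j)

/-! ### Walsh coefficients of the one-dimensional exponential. -/

/-- The Walsh coefficient of `exp(-v t)`. -/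
def expWalshCoeff {L : ℕ} (k : Fin L → Bool) (v : ℝ) : ℝ :=
  ∫ t, Real.exp (-(v * t)) * walsh k t ∂unitVol

/-- On the right half the exponential is `exp (-(v / 2))` times its copy on the left half, so the
leading digit splits off as a factor. -/
lemma expWalshCoeff_succ {L : ℕ} (k : Fin (L + 1) → Bool) (v : ℝ) :
    expWalshCoeff k v = (1 + (if k 0 then -1 else 1) * Real.exp (-(v / 2))) / 2 *
      expWalshCoeff (Fin.tail k) (v / 2) := by
  have h1 : ∫ y, Real.exp (-(v * (y / 2))) * walsh k (y / 2) ∂unitVol =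
      expWalshCoeff (Fin.tail k) (v / 2) :=
    integral_unitVol_congr fun y hy => by
      rw [walsh_half k hy]; ring_nf
  have h2 : ∫ y, Real.exp (-(v * (y / 2 + 1 / 2))) * walsh k (y / 2 + 1 / 2) ∂unitVol =
      (if k 0 then -1 else 1) * Real.exp (-(v / 2)) * expWalshCoeff (Fin.tail k) (v / 2) := by
    rw [expWalshCoeff, ← integral_const_mul]
    refine integral_unitVol_congr fun y hy => ?_
    rw [walsh_half_add k hy, show -(v * (y / 2 + 1 / 2)) = -(v / 2) + -(v / 2 * y) by ring,
      Real.exp_add]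
    ring
  rw [expWalshCoeff, integral_unitVol_halves, h1, h2]
  · ring
  · exact integrable_unitVol_continuousOn_mul (by fun_prop) (measurable_walsh k)
      fun t => (abs_walsh k t).le

/-- The main lower bound for the Walsh coefficients of the exponential function. -/
lemma le_expWalshCoeff {L : ℕ} (k : Fin L → Bool) {v : ℝ} (hv : 0 < v) :
    depthFactor L v * (v ^ digitCount k * digitWeight k) ≤ expWalshCoeff k v := by
  induction L generalizing v with
  | zero => simp [digitCount, digitWeight, depthFactor_zero, expWalshCoeff, walsh,
      integral_exp_neg_mul hv]
  | succ L ih =>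
    have hv2 := half_pos hv
    have h := ih (Fin.tail k) hv2
    have hE := expMean_pos hv2
    have hw := digitWeight_pos (Fin.tail k)
    have hd := depthFactor_pos L hv2
    rw [expWalshCoeff_succ, depthFactor_succ, digitCount, digitWeight]
    -- For a nonzero leading digit this is an equality; for a zero digit it is the trapezoidal bound
    -- `expMean_le`.
    have key : expMean (v / 2) * (if k 0 then v / 4 else 1) ≤
        (1 + (if k 0 then -1 else 1) * Real.exp (-(v / 2))) / 2 := by
      cases k 0
      · simpa using expMean_le hv2
      · simp only [expMean, if_true]
        apply le_of_eq
        field_simp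
        ring
    have hc : 0 ≤ expMean (v / 2) * (if k 0 then v / 4 else 1) := by
      split_ifs <;> positivity
    calc _ = (expMean (v / 2) * (if k 0 then v / 4 else 1)) *
          (depthFactor L (v / 2) *
            ((v / 2) ^ digitCount (Fin.tail k) * digitWeight (Fin.tail k))) := by
          rw [div_pow, div_pow, one_pow, pow_add]
          cases k 0 <;> simp <;> ring
      _ ≤ _ := mul_le_mul key h (by positivity) (hc.trans key)

/-! ### One-dimensional integration by parts against Walsh functions. -/

lemma uniqueDiffOn_unitInterval : UniqueDiffOn ℝ (Set.Icc (0 : ℝ) 1) :=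
  uniqueDiffOn_Icc zero_lt_one

lemma contDiffOn_iteratedDerivWithin_unitInterval {φ : ℝ → ℝ}
    (hφ : ContDiffOn ℝ ∞ φ (Set.Icc 0 1)) (n : ℕ) :
    ContDiffOn ℝ ∞ (iteratedDerivWithin n φ (Set.Icc 0 1)) (Set.Icc 0 1) := by
  induction n with
  | zero => simpa using hφ
  | succ n ih =>
    rw [iteratedDerivWithin_succ]
    exact ih.derivWithin (m := ∞) uniqueDiffOn_unitInterval (by simp)

lemma mapsTo_half_add {c : ℝ} (hc : c ∈ Set.Icc (0 : ℝ) (1 / 2)) :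
    Set.MapsTo (fun y : ℝ => y / 2 + c) (Set.Icc 0 1) (Set.Icc 0 1) := fun y hy =>
  ⟨by linarith [hy.1, hc.1], by linarith [hy.2, hc.2]⟩

lemma contDiffOn_comp_half_add {φ : ℝ → ℝ} (hφ : ContDiffOn ℝ ∞ φ (Set.Icc 0 1)) {c : ℝ}
    (hc : c ∈ Set.Icc (0 : ℝ) (1 / 2)) :
    ContDiffOn ℝ ∞ (fun y => φ (y / 2 + c)) (Set.Icc 0 1) :=
  hφ.comp (ContDiff.contDiffOn (by fun_prop)) (mapsTo_half_add hc)

lemma iteratedDerivWithin_comp_half_add {φ : ℝ → ℝ} (hφ : ContDiffOn ℝ ∞ φ (Set.Icc 0 1)) {c : ℝ}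
    (hc : c ∈ Set.Icc (0 : ℝ) (1 / 2)) (n : ℕ) {y : ℝ} (hy : y ∈ Set.Icc (0 : ℝ) 1) :
    iteratedDerivWithin n (fun y => φ (y / 2 + c)) (Set.Icc 0 1) y =
      (1 / 2) ^ n * iteratedDerivWithin n φ (Set.Icc 0 1) (y / 2 + c) := by
  induction n generalizing y with
  | zero => simp
  | succ n ih =>
    rw [iteratedDerivWithin_succ, iteratedDerivWithin_succ,
      derivWithin_congr (fun z hz => ih hz) (ih hy)]
    have h1 : HasDerivWithinAt (fun y : ℝ => y / 2 + c) (1 / 2) (Set.Icc 0 1) y :=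
      ((hasDerivWithinAt_id y _).div_const 2).add_const c
    have h2 := (((contDiffOn_iteratedDerivWithin_unitInterval hφ n).differentiableOn
      (by simp)) _ (mapsTo_half_add hc hy)).hasDerivWithinAt
    have h3 := (h2.scomp y h1 (mapsTo_half_add hc)).const_mul ((1 / 2 : ℝ) ^ n)
    refine (h3.derivWithin (uniqueDiffOn_unitInterval y hy)).trans ?_
    simp only [smul_eq_mul]
    ring

/-- The indicator function of `y / 2 < z ≤ y / 2 + 1 / 2`. -/
def halfWindow (y z : ℝ) : ℝ := if y / 2 < z ∧ z ≤ y / 2 + 1 / 2 then 1 else 0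

lemma measurable_halfWindow : Measurable fun p : ℝ × ℝ => halfWindow p.1 p.2 := by
  refine Measurable.ite ?_ measurable_const measurable_const
  exact (measurableSet_lt (measurable_fst.div_const 2) measurable_snd).inter
    (measurableSet_le measurable_snd ((measurable_fst.div_const 2).add_const _))

lemma halfWindow_nonneg (y z : ℝ) : 0 ≤ halfWindow y z := by
  unfold halfWindow
  split_ifs <;> norm_num

lemma halfWindow_le_one (y z : ℝ) : halfWindow y z ≤ 1 := by
  unfold halfWindow
  split_ifs <;> norm_num

lemma integral_halfWindow_mul {y : ℝ} (hy : y ∈ Set.Ico (0 : ℝ) 1) (F : ℝ → ℝ) :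
    ∫ z, halfWindow y z * F z ∂unitVol = ∫ z in (y / 2)..(y / 2 + 1 / 2), F z := by
  have h (z : ℝ) : halfWindow y z * F z = (Set.Ioc (y / 2) (y / 2 + 1 / 2)).indicator F z := by
    simp only [halfWindow, Set.indicator, Set.mem_Ioc]
    split_ifs <;> simp
  simp only [h]
  rw [integral_indicator measurableSet_Ioc, Measure.restrict_restrict measurableSet_Ioc,
    Set.inter_eq_left.2, intervalIntegral.integral_of_le (by linarith)]
  exact fun z hz => ⟨by linarith [hz.1, hy.1], by linarith [hz.2, hy.2]⟩

/-- Fubini: the average over the window passes from the derivative `ψ` to the kernel `b`. -/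
lemma integral_halfWindow_swap {b ψ : ℝ → ℝ} {c : ℝ} (hb : Measurable b) (hc : ∀ t, |b t| ≤ c)
    (hψ : Integrable ψ unitVol) :
    ∫ y, b y * ∫ z, halfWindow y z * ψ z ∂unitVol ∂unitVol =
      ∫ z, ψ z * ∫ y, halfWindow y z * b y ∂unitVol ∂unitVol := by
  have hint : Integrable (Function.uncurry fun y z => (halfWindow y z * b y) * ψ z)
      (unitVol.prod unitVol) := by
    refine (hψ.comp_snd unitVol).bdd_mul (c := c) ?_ ?_
    · exact (measurable_halfWindow.mul (hb.comp measurable_fst)).aestronglyMeasurable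
    · refine Filter.Eventually.of_forall fun p => ?_
      rw [Real.norm_eq_abs, abs_mul, abs_of_nonneg (halfWindow_nonneg _ _)]
      exact (mul_le_of_le_one_left (abs_nonneg _) (halfWindow_le_one _ _)).trans (hc _)
  have := integral_integral_swap hint
  simp only [← integral_const_mul]
  refine Eq.trans ?_ (this.trans ?_)
  all_goals
    congr 1 with y
    congr 1 with z
    ring

lemma derivWithin_increment {φ : ℝ → ℝ} (hφ : ContDiffOn ℝ ∞ φ (Set.Icc 0 1)) {y : ℝ}
    (hy : y ∈ Set.Ico (0 : ℝ) 1) :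
    φ (y / 2 + 1 / 2) - φ (y / 2) =
      ∫ z, halfWindow y z * derivWithin φ (Set.Icc 0 1) z ∂unitVol := by
  rw [integral_halfWindow_mul hy]
  have hsub : Set.Icc (y / 2) (y / 2 + 1 / 2) ⊆ Set.Icc 0 1 :=
    Set.Icc_subset_Icc (by linarith [hy.1]) (by linarith [hy.2])
  symm
  apply intervalIntegral.integral_eq_sub_of_hasDerivAt_of_le (by linarith)
    (hφ.continuousOn.mono hsub)
  · intro z hz
    have hz' : Set.Icc (0 : ℝ) 1 ∈ nhds z :=
      Icc_mem_nhds (by linarith [hz.1, hy.1]) (by linarith [hz.2, hy.2])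
    rw [derivWithin_of_mem_nhds hz']
    exact ((hφ.differentiableOn (by simp)).differentiableAt hz').hasDerivAt
  · refine ContinuousOn.intervalIntegrable ?_
    rw [Set.uIcc_of_le (by linarith)]
    exact (hφ.derivWithin (m := ∞) uniqueDiffOn_unitInterval (by simp)).continuousOn.mono hsub

/-- Repeated integration by parts against a Walsh function. -/
lemma exists_walsh_kernel {L : ℕ} (k : Fin L → Bool) :
    ∃ b : ℝ → ℝ, Measurable b ∧ (∀ t, |b t| ≤ 2 * digitWeight k) ∧
      ∫ t, |b t| ∂unitVol ≤ digitWeight k ∧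
      ∀ φ : ℝ → ℝ, ContDiffOn ℝ ∞ φ (Set.Icc 0 1) →
        ∫ t, φ t * walsh k t ∂unitVol =
          ∫ t, iteratedDerivWithin (digitCount k) φ (Set.Icc 0 1) t * b t ∂unitVol := by
  -- The sup bound and the L¹ bound are carried together. At a nonzero digit the new sup bound comes
  -- from the old L¹ bound, so the factor 2 is lost only once and not once per digit.
  induction L with
  | zero =>
    refine ⟨fun _ => 1, measurable_const, ?_, ?_, ?_⟩
    · intro t; simp [digitWeight]
    · simp [digitWeight]
    · intro φ _; simp [digitCount, walsh]
  | succ L ih =>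
    obtain ⟨b, hbm, hb, hb1, hbφ⟩ := ih (Fin.tail k)
    set N := digitCount (Fin.tail k) with hN
    have hw := digitWeight_pos (Fin.tail k)
    have h0 : (0 : ℝ) ∈ Set.Icc (0 : ℝ) (1 / 2) := by simp
    have h1 : (1 / 2 : ℝ) ∈ Set.Icc (0 : ℝ) (1 / 2) := by simp
    have hsplit (φ : ℝ → ℝ) (hφ : ContDiffOn ℝ ∞ φ (Set.Icc 0 1)) :
        ∫ t, φ t * walsh k t ∂unitVol = (1 / 2) * ((1 / 2) ^ N *
            ∫ y, iteratedDerivWithin N φ (Set.Icc 0 1) (y / 2) * b y ∂unitVol) +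
          (1 / 2) * ((if k 0 then -1 else 1) * ((1 / 2) ^ N *
            ∫ y, iteratedDerivWithin N φ (Set.Icc 0 1) (y / 2 + 1 / 2) * b y ∂unitVol)) := by
      have key (c : ℝ) (hc : c ∈ Set.Icc (0 : ℝ) (1 / 2)) :
          ∫ y, φ (y / 2 + c) * walsh (Fin.tail k) y ∂unitVol = (1 / 2) ^ N *
            ∫ y, iteratedDerivWithin N φ (Set.Icc 0 1) (y / 2 + c) * b y ∂unitVol := by
        rw [hbφ _ (contDiffOn_comp_half_add hφ hc), ← integral_const_mul]
        refine integral_unitVol_congr fun y hy => ?_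
        rw [iteratedDerivWithin_comp_half_add hφ hc _ (Set.Ico_subset_Icc_self hy), mul_assoc]
      have key0 := key 0 h0
      simp only [add_zero] at key0
      rw [integral_unitVol_halves (integrable_unitVol_continuousOn_mul hφ.continuousOn
        (measurable_walsh k) fun t => (abs_walsh k t).le), ← key0, ← key _ h1]
      congr 2
      · exact integral_unitVol_congr fun y hy => by rw [walsh_half k hy]
      · rw [← integral_const_mul]
        exact integral_unitVol_congr fun y hy => by rw [walsh_half_add k hy]; ring
    cases hk : k 0
    -- A zero leading digit treats both halves alike: the new kernel consists of two compressed
    -- copies of `b`, scaled by the chain rule factor.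
    · have hfm : Measurable fun t : ℝ => (1 / 2 : ℝ) ^ N * b (Int.fract (2 * t)) :=
        (hbm.comp (measurable_fract.comp (measurable_const_mul _))).const_mul _
      have hfb (t : ℝ) : |(1 / 2 : ℝ) ^ N * b (Int.fract (2 * t))| ≤ 2 * digitWeight k := by
        rw [abs_mul, abs_of_pos (by positivity), digitWeight, hk]
        simp only [Bool.false_eq_true, if_false, one_mul, ← hN]
        nlinarith [hb (Int.fract (2 * t)), show (0 : ℝ) < (1 / 2) ^ N by positivity]
      have hf0 {y : ℝ} (hy : y ∈ Set.Ico (0 : ℝ) 1) : Int.fract (2 * (y / 2)) = y := by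
        rw [mul_div_cancel₀ _ two_ne_zero, Int.fract_eq_self.2 hy]
      have hf1 {y : ℝ} (hy : y ∈ Set.Ico (0 : ℝ) 1) : Int.fract (2 * (y / 2 + 1 / 2)) = y := by
        rw [show 2 * (y / 2 + 1 / 2) = y + 1 by ring, Int.fract_add_one, Int.fract_eq_self.2 hy]
      refine ⟨fun t => (1 / 2) ^ N * b (Int.fract (2 * t)), hfm, hfb, ?_, fun φ hφ => ?_⟩
      · rw [integral_unitVol_halves (integrable_unitVol_of_bounded hfm hfb).abs,
          integral_unitVol_congr (G := fun y => (1 / 2) ^ N * |b y|) fun y hy => by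
            rw [hf0 hy, abs_mul, abs_of_pos (by positivity)],
          integral_unitVol_congr (G := fun y => (1 / 2) ^ N * |b y|)
            (F := fun y => |(1 / 2) ^ N * b (Int.fract (2 * (y / 2 + 1 / 2)))|) fun y hy => by
            rw [hf1 hy, abs_mul, abs_of_pos (by positivity)], integral_const_mul, digitWeight, hk]
        simp only [Bool.false_eq_true, if_false, one_mul, ← hN]
        nlinarith [hb1, show (0 : ℝ) < (1 / 2) ^ N by positivity]
      · have hcount : digitCount k = N := by rw [digitCount, hk]; simp [hN]
        rw [hsplit φ hφ, hcount, integral_unitVol_halves (integrable_unitVol_continuousOn_mul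
          (contDiffOn_iteratedDerivWithin_unitInterval hφ N).continuousOn hfm hfb), hk]
        simp only [Bool.false_eq_true, if_false, one_mul]
        congr 2
        all_goals
          rw [← integral_const_mul]
          refine integral_unitVol_congr fun y hy => ?_
        · rw [hf0 hy]; ring
        · rw [hf1 hy]; ring
    -- A nonzero leading digit produces the difference of the two halves, which is an integral of
    -- one further derivative over a window of length 1/2. The constant `c` combines the Jacobian
    -- 1/2 with the chain rule factor.
    · set c : ℝ := (1 / 2) * (1 / 2) ^ N with hc
      have hc0 : 0 < c := by positivity
      have hcw : c * (digitWeight (Fin.tail k) / 2) = digitWeight k := by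
        rw [digitWeight, hk, hc, ← hN, if_pos rfl]; ring
      have hIm : Measurable fun z => ∫ y, halfWindow y z * b y ∂unitVol :=
        (StronglyMeasurable.integral_prod_left' (f := fun p : ℝ × ℝ => halfWindow p.1 p.2 * b p.1)
          (measurable_halfWindow.mul (hbm.comp measurable_fst)).stronglyMeasurable).measurable
      have hbi : Integrable b unitVol := integrable_unitVol_of_bounded hbm hb
      have hwbi (z : ℝ) : Integrable (fun y => halfWindow y z * |b y|) unitVol :=
        hbi.abs.bdd_mul (c := 1)
          (measurable_halfWindow.comp (measurable_id.prodMk measurable_const)).aestronglyMeasurable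
          (Filter.Eventually.of_forall fun y => by
            rw [Real.norm_eq_abs, abs_of_nonneg (halfWindow_nonneg _ _)]
            exact halfWindow_le_one _ _)
      have hI (z : ℝ) : |∫ y, halfWindow y z * b y ∂unitVol| ≤
          ∫ y, halfWindow y z * |b y| ∂unitVol := by
        refine (abs_integral_le_integral_abs).trans_eq ?_
        simp only [abs_mul, abs_of_nonneg (halfWindow_nonneg _ _)]
      have hI2 (z : ℝ) : |∫ y, halfWindow y z * b y ∂unitVol| ≤ digitWeight (Fin.tail k) :=
        (hI z).trans <| (integral_mono (hwbi z) hbi.abs fun y =>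
          mul_le_of_le_one_left (abs_nonneg _) (halfWindow_le_one _ _)).trans hb1
      have hfm : Measurable fun z => -c * ∫ y, halfWindow y z * b y ∂unitVol := hIm.const_mul _
      have hfb (z : ℝ) : |-c * ∫ y, halfWindow y z * b y ∂unitVol| ≤ 2 * digitWeight k := by
        rw [abs_mul, abs_neg, abs_of_pos hc0, ← hcw]
        nlinarith [hI2 z]
      refine ⟨fun z => -c * ∫ y, halfWindow y z * b y ∂unitVol, hfm, hfb, ?_, fun φ hφ => ?_⟩
      · have hswap := integral_halfWindow_swap (b := fun t => |b t|) (ψ := fun _ => 1)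
          hbm.abs (fun t => by rw [abs_abs]; exact hb t) (integrable_const 1)
        -- Every window has length 1/2; this gains the factor by which the L¹ bound is better than
        -- the sup bound.
        have hhalf : ∫ y, |b y| * ∫ z, halfWindow y z * 1 ∂unitVol ∂unitVol =
            ∫ y, |b y| * (1 / 2) ∂unitVol := integral_unitVol_congr fun y hy => by
          rw [integral_halfWindow_mul hy]; simp
        rw [hhalf, integral_mul_const] at hswap
        simp only [one_mul] at hswap
        have hIi : Integrable (fun z => ∫ y, halfWindow y z * |b y| ∂unitVol) unitVol := by
          refine integrable_unitVol_of_bounded (c := digitWeight (Fin.tail k)) ?_ fun z => ?_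
          · exact (StronglyMeasurable.integral_prod_left'
              (f := fun p : ℝ × ℝ => halfWindow p.1 p.2 * |b p.1|)
              (measurable_halfWindow.mul
                (hbm.abs.comp measurable_fst)).stronglyMeasurable).measurable
          · rw [abs_of_nonneg (integral_nonneg fun y =>
              mul_nonneg (halfWindow_nonneg _ _) (abs_nonneg _))]
            exact (integral_mono (hwbi z) hbi.abs fun y =>
              mul_le_of_le_one_left (abs_nonneg _) (halfWindow_le_one _ _)).trans hb1
        calc _ ≤ ∫ z, c * ∫ y, halfWindow y z * |b y| ∂unitVol ∂unitVol := by
              refine integral_mono (integrable_unitVol_of_bounded hfm hfb).abs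
                (hIi.const_mul _) fun z => ?_
              dsimp only
              rw [abs_mul, abs_neg, abs_of_pos hc0]
              exact mul_le_mul_of_nonneg_left (hI z) hc0.le
          _ = c * ((∫ y, |b y| ∂unitVol) * (1 / 2)) := by rw [integral_const_mul, hswap]
          _ ≤ c * (digitWeight (Fin.tail k) / 2) := by
              refine mul_le_mul_of_nonneg_left ?_ hc0.le
              linarith
          _ = _ := hcw
      · have hcount : digitCount k = N + 1 := by rw [digitCount, hk]; simp [hN]
        have hΦ := contDiffOn_iteratedDerivWithin_unitInterval hφ N
        set Φ := iteratedDerivWithin N φ (Set.Icc 0 1) with hΦdef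
        have hΦ' : iteratedDerivWithin (N + 1) φ (Set.Icc 0 1) =
            derivWithin Φ (Set.Icc 0 1) := iteratedDerivWithin_succ
        have hi0 : Integrable (fun y => Φ (y / 2) * b y) unitVol :=
          integrable_unitVol_continuousOn_mul
            (by simpa using (contDiffOn_comp_half_add hΦ h0).continuousOn) hbm hb
        have hi1 : Integrable (fun y => Φ (y / 2 + 1 / 2) * b y) unitVol :=
          integrable_unitVol_continuousOn_mul (contDiffOn_comp_half_add hΦ h1).continuousOn hbm hb
        rw [hsplit φ hφ, hcount, hΦ', hk]
        calc _ = -c * ∫ y, (Φ (y / 2 + 1 / 2) * b y - Φ (y / 2) * b y) ∂unitVol := by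
              rw [integral_sub hi1 hi0, hc, if_pos rfl]; ring
          _ = -c * ∫ y, b y * ∫ z, halfWindow y z * derivWithin Φ (Set.Icc 0 1) z ∂unitVol
                ∂unitVol := by
              congr 1
              refine integral_unitVol_congr fun y hy => ?_
              rw [← derivWithin_increment hΦ hy]; ring
          _ = _ := by
              rw [integral_halfWindow_swap hbm hb (integrable_unitVol_of_continuousOn
                (hΦ.derivWithin (m := ∞) uniqueDiffOn_unitInterval (by simp)).continuousOn),
                ← integral_const_mul]
              congr 1
              ext z
              ring

/-! ### The cube, its partial derivatives, and coordinatewise integration by parts. -/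

/-- Lebesgue measure on `[0,1)^s`. -/
abbrev cubeVol (s : ℕ) : Measure (Fin s → ℝ) := Measure.pi fun _ => unitVol

lemma restrict_halfOpenCube (s : ℕ) : volume.restrict (halfOpenCube s) = cubeVol s :=
  Measure.restrict_pi_pi _ _

lemma integral_eq_cubeVol {s : ℕ} (f : (Fin s → ℝ) → ℝ) : integral f = ∫ x, f x ∂cubeVol s := by
  rw [integral, restrict_halfOpenCube]

lemma restrict_closedCube (s : ℕ) : volume.restrict (closedCube s) = cubeVol s := by
  rw [← restrict_halfOpenCube]
  exact (Measure.restrict_congr_set (Measure.univ_pi_Ico_ae_eq_Icc (μ := fun _ => volume))).symm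

lemma normL1_eq_cubeVol {s : ℕ} (f : (Fin s → ℝ) → ℝ) : normL1 f = ∫ x, |f x| ∂cubeVol s := by
  rw [normL1, restrict_closedCube]

lemma mem_closedCube {s : ℕ} {x : Fin s → ℝ} :
    x ∈ closedCube s ↔ ∀ j, x j ∈ Set.Icc (0 : ℝ) 1 := by
  simp only [closedCube, Set.mem_Icc, Pi.le_def, Pi.zero_apply, Pi.one_apply, forall_and]

lemma mem_halfOpenCube {s : ℕ} {x : Fin s → ℝ} :
    x ∈ halfOpenCube s ↔ ∀ j, x j ∈ Set.Ico (0 : ℝ) 1 := by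
  simp [halfOpenCube]

lemma halfOpenCube_subset (s : ℕ) : halfOpenCube s ⊆ closedCube s := fun _ hx =>
  mem_closedCube.2 fun j => Set.Ico_subset_Icc_self (mem_halfOpenCube.1 hx j)

lemma ae_mem_halfOpenCube (s : ℕ) : ∀ᵐ x ∂cubeVol s, x ∈ halfOpenCube s := by
  rw [← restrict_halfOpenCube]
  exact ae_restrict_mem (MeasurableSet.univ_pi fun _ => measurableSet_Ico)

lemma integral_cubeVol_congr {s : ℕ} {F G : (Fin s → ℝ) → ℝ}
    (h : ∀ x ∈ halfOpenCube s, F x = G x) : ∫ x, F x ∂cubeVol s = ∫ x, G x ∂cubeVol s :=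
  integral_congr_ae ((ae_mem_halfOpenCube s).mono h)

lemma isCompact_closedCube (s : ℕ) : IsCompact (closedCube s) := isCompact_Icc

lemma integrable_cubeVol_of_continuousOn {s : ℕ} {F : (Fin s → ℝ) → ℝ}
    (h : ContinuousOn F (closedCube s)) : Integrable F (cubeVol s) := by
  rw [← restrict_closedCube]
  exact h.integrableOn_compact (isCompact_closedCube s)

lemma integrable_cubeVol_continuousOn_mul {s : ℕ} {F w : (Fin s → ℝ) → ℝ} {c : ℝ}
    (h : ContinuousOn F (closedCube s)) (hw : Measurable w) (hc : ∀ x, |w x| ≤ c) :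
    Integrable (fun x => F x * w x) (cubeVol s) :=
  (integrable_cubeVol_of_continuousOn h).mul_bdd (c := c) hw.aestronglyMeasurable
    (Filter.Eventually.of_forall hc)

/-- Resampling one coordinate preserves the uniform distribution on the cube. -/
lemma measurePreserving_update (s : ℕ) (j : Fin s) :
    MeasurePreserving (fun p : (Fin s → ℝ) × ℝ => Function.update p.1 j p.2)
      ((cubeVol s).prod unitVol) (cubeVol s) := by
  refine ⟨measurable_update', (Measure.pi_eq fun S hS => ?_).symm⟩
  rw [Measure.map_apply measurable_update' (MeasurableSet.univ_pi hS)]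
  have h : (fun p : (Fin s → ℝ) × ℝ => Function.update p.1 j p.2) ⁻¹' Set.univ.pi S =
      Set.univ.pi (Function.update S j Set.univ) ×ˢ S j := by
    ext ⟨x, t⟩
    simp only [Set.mem_preimage, Set.mem_pi, Set.mem_univ, true_imp_iff, Set.mem_prod]
    constructor
    · refine fun hx => ⟨fun i => ?_, by simpa using hx j⟩
      rcases eq_or_ne i j with rfl | hij
      · simp
      · simpa [hij] using hx i
    · rintro ⟨hx, ht⟩ i
      rcases eq_or_ne i j with rfl | hij
      · simpa using ht
      · simpa [hij] using hx i
  rw [h, Measure.prod_prod, Measure.pi_pi, ← Finset.mul_prod_erase _ _ (Finset.mem_univ j),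
    ← Finset.mul_prod_erase _ _ (Finset.mem_univ j), Function.update_self, measure_univ, one_mul,
    mul_comm]
  congr 1
  refine Finset.prod_congr rfl fun i hi => ?_
  rw [Function.update_of_ne (Finset.ne_of_mem_erase hi)]

/-- Fubini in one coordinate without splitting the index type: coordinate `j` is resampled, and the
outer integration over the old one is harmless. -/
lemma integral_cubeVol_update {s : ℕ} (j : Fin s) {H : (Fin s → ℝ) → ℝ}
    (hH : Integrable H (cubeVol s)) :
    ∫ x, H x ∂cubeVol s = ∫ x, ∫ t, H (Function.update x j t) ∂unitVol ∂cubeVol s := by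
  have hp := measurePreserving_update s j
  have h1 := hp.integrable_comp_of_integrable hH
  have h2 := integral_map (f := H) hp.measurable.aemeasurable (by rw [hp.map_eq]; exact hH.1)
  rw [hp.map_eq] at h2
  rw [h2]
  exact integral_prod _ h1

lemma uniqueDiffOn_closedCube (s : ℕ) : UniqueDiffOn ℝ (closedCube s) := by
  rw [closedCube, ← Set.pi_univ_Icc]
  exact UniqueDiffOn.univ_pi fun _ => uniqueDiffOn_unitInterval

lemma update_mem_closedCube {s : ℕ} {x : Fin s → ℝ} (hx : x ∈ closedCube s) (j : Fin s) {t : ℝ}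
    (ht : t ∈ Set.Icc (0 : ℝ) 1) : Function.update x j t ∈ closedCube s := by
  rw [mem_closedCube] at *
  intro i
  rcases eq_or_ne i j with rfl | hij
  · simpa using ht
  · simpa [hij] using hx i

/-- Identifies the one-sided derivative along a line with a Fréchet derivative within the cube, from
which smoothness of partial derivatives follows. -/
lemma partialDeriv_eq_fderivWithin {s : ℕ} {f : (Fin s → ℝ) → ℝ} (j : Fin s)
    (hf : DifferentiableOn ℝ f (closedCube s)) {x : Fin s → ℝ} (hx : x ∈ closedCube s) :
    partialDeriv j f x = fderivWithin ℝ f (closedCube s) x (Pi.single j 1) := by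
  have hxj := mem_closedCube.1 hx j
  have h1 := (hasDerivAt_update x j (x j)).hasDerivWithinAt (s := Set.Icc 0 1)
  have h2 : HasFDerivWithinAt f (fderivWithin ℝ f (closedCube s) x) (closedCube s)
      (Function.update x j (x j)) := by
    rw [Function.update_eq_self]
    exact (hf x hx).hasFDerivWithinAt
  have h3 := h2.comp_hasDerivWithinAt (x j) h1 fun t ht => update_mem_closedCube hx j ht
  exact h3.derivWithin (uniqueDiffOn_unitInterval _ hxj)

lemma contDiffOn_partialDeriv {s : ℕ} {f : (Fin s → ℝ) → ℝ} (j : Fin s)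
    (hf : ContDiffOn ℝ ∞ f (closedCube s)) : ContDiffOn ℝ ∞ (partialDeriv j f) (closedCube s) := by
  refine ContDiffOn.congr ?_ fun x hx =>
    partialDeriv_eq_fderivWithin j (hf.differentiableOn (by simp)) hx
  exact (hf.fderivWithin (m := ∞) (uniqueDiffOn_closedCube s) (by simp)).clm_apply
    contDiffOn_const

lemma contDiffOn_iterate_partialDeriv {s : ℕ} {f : (Fin s → ℝ) → ℝ} (j : Fin s)
    (hf : ContDiffOn ℝ ∞ f (closedCube s)) (n : ℕ) :
    ContDiffOn ℝ ∞ ((partialDeriv j)^[n] f) (closedCube s) := by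
  induction n with
  | zero => exact hf
  | succ n ih =>
    rw [Function.iterate_succ_apply']
    exact contDiffOn_partialDeriv j ih

lemma contDiffOn_foldr_partialDeriv {s : ℕ} {f : (Fin s → ℝ) → ℝ} (α : Fin s → ℕ)
    (hf : ContDiffOn ℝ ∞ f (closedCube s)) (l : List (Fin s)) :
    ContDiffOn ℝ ∞ (l.foldr (fun j h => (partialDeriv j)^[α j] h) f) (closedCube s) := by
  induction l with
  | nil => exact hf
  | cons j l ih => exact contDiffOn_iterate_partialDeriv j ih _

lemma contDiffOn_mixedDeriv {s : ℕ} {f : (Fin s → ℝ) → ℝ} (α : Fin s → ℕ)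
    (hf : ContDiffOn ℝ ∞ f (closedCube s)) : ContDiffOn ℝ ∞ (mixedDeriv α f) (closedCube s) :=
  contDiffOn_foldr_partialDeriv α hf _

lemma iterate_partialDeriv_update {s : ℕ} (f : (Fin s → ℝ) → ℝ) (j : Fin s) (n : ℕ)
    (x : Fin s → ℝ) (t : ℝ) :
    (partialDeriv j)^[n] f (Function.update x j t) =
      iteratedDerivWithin n (fun t => f (Function.update x j t)) (Set.Icc 0 1) t := by
  induction n generalizing t with
  | zero => simp
  | succ n ih =>
    rw [Function.iterate_succ_apply', iteratedDerivWithin_succ, partialDeriv]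
    simp only [Function.update_idem, Function.update_self, ih]

lemma contDiffOn_update {s : ℕ} {f : (Fin s → ℝ) → ℝ} (hf : ContDiffOn ℝ ∞ f (closedCube s))
    {x : Fin s → ℝ} (hx : x ∈ closedCube s) (j : Fin s) :
    ContDiffOn ℝ ∞ (fun t => f (Function.update x j t)) (Set.Icc 0 1) :=
  hf.comp (contDiff_update ∞ x j).contDiffOn fun _ ht => update_mem_closedCube hx j ht

lemma integral_mul_eq_integral_iterate_partialDeriv_mul {s : ℕ} {f w : (Fin s → ℝ) → ℝ}
    {j : Fin s} {n : ℕ} {a b : ℝ → ℝ} {c d : ℝ} (hf : ContDiffOn ℝ ∞ f (closedCube s))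
    (hw : Measurable w) (hwc : ∀ x, |w x| ≤ c) (hwj : ∀ x t, w (Function.update x j t) = w x)
    (ha : Measurable a) (hb : Measurable b) (had : ∀ t, |a t| ≤ d) (hbd : ∀ t, |b t| ≤ d)
    (h : ∀ φ : ℝ → ℝ, ContDiffOn ℝ ∞ φ (Set.Icc 0 1) →
      ∫ t, φ t * a t ∂unitVol = ∫ t, iteratedDerivWithin n φ (Set.Icc 0 1) t * b t ∂unitVol) :
    ∫ x, f x * (a (x j) * w x) ∂cubeVol s =
      ∫ x, (partialDeriv j)^[n] f x * (b (x j) * w x) ∂cubeVol s := by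
  have hint {g : (Fin s → ℝ) → ℝ} {e : ℝ → ℝ} (hg : ContDiffOn ℝ ∞ g (closedCube s))
      (he : Measurable e) (hed : ∀ t, |e t| ≤ d) :
      Integrable (fun x => g x * (e (x j) * w x)) (cubeVol s) := by
    refine integrable_cubeVol_continuousOn_mul (c := d * c) hg.continuousOn
      ((he.comp (measurable_pi_apply j)).mul hw) fun x => ?_
    rw [abs_mul]
    exact mul_le_mul (hed _) (hwc _) (abs_nonneg _) ((abs_nonneg _).trans (hed 0))
  rw [integral_cubeVol_update j (hint hf ha had),
    integral_cubeVol_update j (hint (contDiffOn_iterate_partialDeriv j hf n) hb hbd)]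
  refine integral_cubeVol_congr fun x hx => ?_
  simp only [hwj, Function.update_self, ← mul_assoc, integral_mul_const,
    iterate_partialDeriv_update]
  rw [h _ (contDiffOn_update hf (halfOpenCube_subset s hx) j)]

/-- Induction over the coordinates already treated. Since the list has no repetitions, the weight in
the next coordinate is still `a j`, and the remaining weights do not depend on that coordinate. -/
lemma integral_mul_prod_eq_integral_foldr {s : ℕ} {f : (Fin s → ℝ) → ℝ} {α : Fin s → ℕ}
    {a b : Fin s → ℝ → ℝ} {d : Fin s → ℝ} (hf : ContDiffOn ℝ ∞ f (closedCube s))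
    (ha : ∀ i, Measurable (a i)) (hb : ∀ i, Measurable (b i))
    (had : ∀ i t, |a i t| ≤ d i) (hbd : ∀ i t, |b i t| ≤ d i)
    (h : ∀ i, ∀ φ : ℝ → ℝ, ContDiffOn ℝ ∞ φ (Set.Icc 0 1) → ∫ t, φ t * a i t ∂unitVol =
      ∫ t, iteratedDerivWithin (α i) φ (Set.Icc 0 1) t * b i t ∂unitVol)
    (l : List (Fin s)) (hl : l.Nodup) :
    ∫ x, f x * ∏ i, a i (x i) ∂cubeVol s =
      ∫ x, l.foldr (fun j h => (partialDeriv j)^[α j] h) f x *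
        ∏ i, (if i ∈ l then b i else a i) (x i) ∂cubeVol s := by
  induction l with
  | nil => simp
  | cons j l ih =>
    rw [List.nodup_cons] at hl
    rw [ih hl.2, List.foldr_cons]
    set e : Fin s → ℝ → ℝ := fun i => if i ∈ l then b i else a i with he
    have hem (i : Fin s) : Measurable (e i) := by
      simp only [he]; split_ifs; exacts [hb i, ha i]
    have hed (i : Fin s) (t : ℝ) : |e i t| ≤ d i := by
      simp only [he]; split_ifs; exacts [hbd i t, had i t]
    have h1 (x : Fin s → ℝ) : ∏ i, (if i ∈ l then b i else a i) (x i) =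
        a j (x j) * ∏ i ∈ Finset.univ.erase j, e i (x i) := by
      rw [← Finset.mul_prod_erase _ _ (Finset.mem_univ j), if_neg hl.1]
    have h2 (x : Fin s → ℝ) : ∏ i, (if i ∈ j :: l then b i else a i) (x i) =
        b j (x j) * ∏ i ∈ Finset.univ.erase j, e i (x i) := by
      rw [← Finset.mul_prod_erase _ _ (Finset.mem_univ j), if_pos List.mem_cons_self]
      congr 1
      refine Finset.prod_congr rfl fun i hi => ?_
      simp only [List.mem_cons, Finset.ne_of_mem_erase hi, false_or, he]
    simp only [h1, h2]
    refine integral_mul_eq_integral_iterate_partialDeriv_mul (c := ∏ i ∈ Finset.univ.erase j, d i)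
      (contDiffOn_foldr_partialDeriv α hf l)
      (Finset.measurable_prod _ fun i _ => (hem i).comp (measurable_pi_apply i)) (fun x => ?_)
      (fun x t => ?_) (ha j) (hb j) (had j) (hbd j) (h j)
    · rw [Finset.abs_prod]
      exact Finset.prod_le_prod (fun _ _ => abs_nonneg _) fun i _ => hed _ _
    · exact Finset.prod_congr rfl fun i hi => by
        rw [Function.update_of_ne (Finset.ne_of_mem_erase hi)]

/-! ### Multivariate Walsh coefficients. -/

/-- The multivariate Walsh function of depth `L`. -/
def walshProd {s L : ℕ} (k : Fin s → Fin L → Bool) (x : Fin s → ℝ) : ℝ := ∏ j, walsh (k j) (x j)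

lemma measurable_walshProd {s L : ℕ} (k : Fin s → Fin L → Bool) : Measurable (walshProd k) :=
  Finset.measurable_prod _ fun j _ => (measurable_walsh (k j)).comp (measurable_pi_apply j)

lemma abs_walshProd {s L : ℕ} (k : Fin s → Fin L → Bool) (x : Fin s → ℝ) :
    |walshProd k x| = 1 := by
  simp [walshProd, Finset.abs_prod, abs_walsh]

/-- The multivariate Walsh coefficient. -/
def walshCoeff {s L : ℕ} (f : (Fin s → ℝ) → ℝ) (k : Fin s → Fin L → Bool) : ℝ :=
  ∫ x, f x * walshProd k x ∂cubeVol s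

/-- The bound for Walsh coefficients by norms of mixed derivatives. -/
lemma abs_walshCoeff_le_normL1 {s L : ℕ} {f : (Fin s → ℝ) → ℝ}
    (hf : ContDiffOn ℝ ∞ f (closedCube s)) (k : Fin s → Fin L → Bool) :
    |walshCoeff f k| ≤ normL1 (mixedDeriv (fun j => digitCount (k j)) f) *
      ∏ j, (2 * digitWeight (k j)) := by
  choose b hbm hb _ hbφ using fun j => exists_walsh_kernel (k j)
  have h := integral_mul_prod_eq_integral_foldr (a := fun j => walsh (k j)) (b := b)
    -- This common bound for `walsh` and `b` serves integrability only; the estimate below uses the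
    -- sharper bound on `b`.
    (d := fun j => max 1 (2 * digitWeight (k j))) hf (fun j => measurable_walsh (k j)) hbm
    (fun j t => (abs_walsh (k j) t).le.trans (le_max_left _ _))
    (fun j t => (hb j t).trans (le_max_right _ _)) hbφ (List.finRange s) (List.nodup_finRange s)
  simp only [List.mem_finRange, if_true] at h
  have hc := (contDiffOn_mixedDeriv (fun j => digitCount (k j)) hf).continuousOn
  have hbb (x : Fin s → ℝ) : |∏ i, b i (x i)| ≤ ∏ j, (2 * digitWeight (k j)) := by
    rw [Finset.abs_prod]
    exact Finset.prod_le_prod (fun _ _ => abs_nonneg _) fun j _ => hb j _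
  rw [walshCoeff, normL1_eq_cubeVol, ← integral_mul_const]
  refine (congrArg abs h).trans_le (abs_integral_le_integral_abs.trans ?_)
  refine integral_mono (integrable_cubeVol_continuousOn_mul hc
    (Finset.measurable_prod _ fun i _ => (hbm i).comp (measurable_pi_apply i)) hbb).abs
    ((integrable_cubeVol_of_continuousOn hc).abs.mul_const _) fun x => ?_
  dsimp only
  rw [abs_mul]
  exact mul_le_mul_of_nonneg_left (hbb x) (abs_nonneg _)

/-! ### The exponential function as an element of the weighted space. -/

lemma expFun_eq_prod {s : ℕ} (u x : Fin s → ℝ) : expFun u x = ∏ j, Real.exp (-(u j * x j)) := by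
  rw [expFun, ← Finset.sum_neg_distrib, Real.exp_sum]

lemma expFun_pos {s : ℕ} (u x : Fin s → ℝ) : 0 < expFun u x := Real.exp_pos _

lemma contDiff_expFun {s : ℕ} (u : Fin s → ℝ) : ContDiff ℝ ∞ (expFun u) := by
  unfold expFun
  fun_prop

lemma integral_expFun {s : ℕ} {u : Fin s → ℝ} (hu : ∀ j, 0 < u j) :
    ∫ x, expFun u x ∂cubeVol s = constA u := by
  simp only [expFun_eq_prod]
  rw [integral_fintype_prod_eq_prod (fun j t => Real.exp (-(u j * t))), constA_eq]
  exact Finset.prod_congr rfl fun j _ => integral_exp_neg_mul (hu j)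

lemma walshCoeff_expFun {s L : ℕ} (u : Fin s → ℝ) (k : Fin s → Fin L → Bool) :
    walshCoeff (expFun u) k = ∏ j, expWalshCoeff (k j) (u j) := by
  simp only [walshCoeff, expFun_eq_prod, walshProd, ← Finset.prod_mul_distrib]
  exact integral_fintype_prod_eq_prod (fun j t => Real.exp (-(u j * t)) * walsh (k j) t)

/-- The derivative formulas for the exponential are only asserted on the closed cube; this locality
allows them to be iterated. -/
lemma partialDeriv_eqOn {s : ℕ} {f g : (Fin s → ℝ) → ℝ} (h : Set.EqOn f g (closedCube s))
    (j : Fin s) : Set.EqOn (partialDeriv j f) (partialDeriv j g) (closedCube s) := fun x hx =>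
  derivWithin_congr (fun _ ht => h (update_mem_closedCube hx j ht))
    (h (by rwa [Function.update_eq_self]))

lemma partialDeriv_const_mul_expFun {s : ℕ} (u : Fin s → ℝ) (c : ℝ) (j : Fin s) :
    Set.EqOn (partialDeriv j fun x => c * expFun u x) (fun x => (-u j * c) * expFun u x)
      (closedCube s) := by
  intro x hx
  have h1 (t : ℝ) : c * expFun u (Function.update x j t) =
      c * (∏ i ∈ Finset.univ.erase j, Real.exp (-(u i * x i))) * Real.exp (-(u j * t)) := by
    rw [expFun_eq_prod, ← Finset.mul_prod_erase _ _ (Finset.mem_univ j), Function.update_self,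
      Finset.prod_congr rfl fun i hi => by rw [Function.update_of_ne (Finset.ne_of_mem_erase hi)]]
    ring
  have h2 : HasDerivAt (fun t => c * expFun u (Function.update x j t))
      (-u j * c * expFun u x) (x j) := by
    simp only [h1]
    have h3 := (((hasDerivAt_id (x j)).const_mul (u j)).neg.exp).const_mul
      (c * (∏ i ∈ Finset.univ.erase j, Real.exp (-(u i * x i))))
    convert! h3 using 1
    rw [expFun_eq_prod, ← Finset.mul_prod_erase _ _ (Finset.mem_univ j)]
    simp only [id, Pi.neg_apply]
    ring
  exact h2.hasDerivWithinAt.derivWithin (uniqueDiffOn_unitInterval _ (mem_closedCube.1 hx j))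

lemma iterate_partialDeriv_const_mul_expFun {s : ℕ} {u : Fin s → ℝ} {c : ℝ}
    {f : (Fin s → ℝ) → ℝ} (hf : Set.EqOn f (fun x => c * expFun u x) (closedCube s)) (j : Fin s)
    (n : ℕ) : Set.EqOn ((partialDeriv j)^[n] f) (fun x => ((-u j) ^ n * c) * expFun u x)
      (closedCube s) := by
  induction n with
  | zero => simpa using hf
  | succ n ih =>
    rw [Function.iterate_succ_apply', pow_succ', mul_assoc]
    exact (partialDeriv_eqOn ih j).trans (partialDeriv_const_mul_expFun u _ j)

lemma mixedDeriv_const_mul_expFun {s : ℕ} (u : Fin s → ℝ) (c : ℝ) (α : Fin s → ℕ) :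
    Set.EqOn (mixedDeriv α fun x => c * expFun u x)
      (fun x => ((∏ j, (-u j) ^ α j) * c) * expFun u x) (closedCube s) := by
  rw [Fin.prod_univ_def]
  unfold mixedDeriv
  induction List.finRange s with
  | nil => simpa using Set.eqOn_refl _ _
  | cons j l ih =>
    rw [List.foldr_cons, List.map_cons, List.prod_cons, mul_assoc]
    exact iterate_partialDeriv_const_mul_expFun ih j _

/-- Differentiation multiplies the exponential by powers of `-u j`, exactly cancelled by the
weights. The quotient is therefore independent of `α`. -/
lemma weightedDerivNorm_const_mul_expFun {s : ℕ} {u : Fin s → ℝ} (hu : ∀ j, 0 < u j) (c : ℝ)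
    (α : Fin s → ℕ) : weightedDerivNorm u (fun x => c * expFun u x) α = |c| * constA u := by
  have hpos : 0 < ∏ j, u j ^ α j := Finset.prod_pos fun j _ => pow_pos (hu j) _
  rw [weightedDerivNorm, normL1_eq_cubeVol, div_eq_iff hpos.ne', ← integral_expFun hu,
    ← integral_const_mul, ← integral_mul_const]
  refine integral_cubeVol_congr fun x hx => ?_
  rw [mixedDeriv_const_mul_expFun u c α (halfOpenCube_subset s hx), abs_mul, abs_mul,
    Finset.abs_prod, abs_of_pos (expFun_pos u x)]
  simp only [abs_pow, abs_neg, abs_of_pos (hu _)]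
  ring

lemma const_mul_expFun_mem {s : ℕ} {u : Fin s → ℝ} (hu : ∀ j, 0 < u j) (c : ℝ) :
    (fun x => c * expFun u x) ∈ weightedSpace u :=
  ⟨(contDiff_const.mul (contDiff_expFun u)).contDiffOn, |c| * constA u, by
    rintro _ ⟨α, rfl⟩
    exact (weightedDerivNorm_const_mul_expFun hu c α).le⟩

lemma weightedNorm_const_mul_expFun {s : ℕ} {u : Fin s → ℝ} (hu : ∀ j, 0 < u j) (c : ℝ) :
    weightedNorm u (fun x => c * expFun u x) = |c| * constA u := by
  simp only [weightedNorm, weightedDerivNorm_const_mul_expFun hu, ciSup_const]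

lemma expFun_mem {s : ℕ} {u : Fin s → ℝ} (hu : ∀ j, 0 < u j) : expFun u ∈ weightedSpace u := by
  simpa using const_mul_expFun_mem hu 1

lemma weightedNorm_expFun {s : ℕ} {u : Fin s → ℝ} (hu : ∀ j, 0 < u j) :
    weightedNorm u (expFun u) = constA u := by
  simpa using weightedNorm_const_mul_expFun hu 1

lemma err_const_mul {s : ℕ} (f : (Fin s → ℝ) → ℝ) (c : ℝ) (P : Finset (Fin s → ℝ)) :
    err (fun x => c * f x) P = c * err f P := by
  simp only [err, quadrature, integral, integral_const_mul, ← Finset.mul_sum]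
  ring

/-! ### Termwise comparison of Walsh coefficients. -/

lemma constB_mul_le_walshCoeff_expFun {s L : ℕ} (hL : 1 ≤ L) {u : Fin s → ℝ} (hu : ∀ j, 0 < u j)
    (k : Fin s → Fin L → Bool) :
    constB u * ∏ j, (u j ^ digitCount (k j) * digitWeight (k j)) ≤ walshCoeff (expFun u) k := by
  have hp (j : Fin s) : 0 ≤ u j ^ digitCount (k j) * digitWeight (k j) :=
    mul_nonneg (pow_pos (hu j) _).le (digitWeight_pos _).le
  rw [constB_eq, walshCoeff_expFun, ← Finset.prod_mul_distrib]
  refine Finset.prod_le_prod (fun j _ => mul_nonneg (depthInf_pos (hu j)).le (hp j)) fun j _ => ?_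
  exact (mul_le_mul_of_nonneg_right (depthInf_le hL (hu j)) (hp j)).trans
    (le_expWalshCoeff (k j) (hu j))

/-- Upper bound for `f` and lower bound for the exponential contain the same powers of `u` and the
same digit weights, so only `2 ^ s / B` survives. -/
lemma abs_walshCoeff_le_expFun {s L : ℕ} (hL : 1 ≤ L) {u : Fin s → ℝ} (hu : ∀ j, 0 < u j)
    {f : (Fin s → ℝ) → ℝ} (hf : f ∈ weightedSpace u) (hf1 : weightedNorm u f ≤ 1)
    (k : Fin s → Fin L → Bool) :
    |walshCoeff f k| ≤ 2 ^ s * (constB u)⁻¹ * walshCoeff (expFun u) k := by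
  have hB := constB_pos hu
  have hpos : 0 < ∏ j, u j ^ digitCount (k j) := Finset.prod_pos fun j _ => pow_pos (hu j) _
  have hw : 0 < ∏ j, (2 * digitWeight (k j)) :=
    Finset.prod_pos fun j _ => mul_pos two_pos (digitWeight_pos _)
  have hn : normL1 (mixedDeriv (fun j => digitCount (k j)) f) ≤ ∏ j, u j ^ digitCount (k j) :=
    (div_le_one hpos).1 ((le_ciSup hf.2 _).trans hf1)
  calc _ ≤ _ := abs_walshCoeff_le_normL1 hf.1 k
    _ ≤ (∏ j, u j ^ digitCount (k j)) * ∏ j, (2 * digitWeight (k j)) :=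
        mul_le_mul_of_nonneg_right hn hw.le
    _ = 2 ^ s * (constB u)⁻¹ *
          (constB u * ∏ j, (u j ^ digitCount (k j) * digitWeight (k j))) := by
        rw [Finset.prod_mul_distrib, Finset.prod_mul_distrib, Finset.prod_const, Finset.card_univ,
          Fintype.card_fin]
        field_simp
    _ ≤ _ := mul_le_mul_of_nonneg_left (constB_mul_le_walshCoeff_expFun hL hu k) (by positivity)

/-! ### Dyadic averages as partial Walsh sums. -/

/-- The dyadic local averages of `f` of depth `L` are the partial sums of its Walsh series. -/
lemma sum_integral_dirichletKernel {s L : ℕ} {f : (Fin s → ℝ) → ℝ}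
    (hf : ContinuousOn f (closedCube s)) (y : Fin s → ℝ) :
    ∫ x, f x * ∏ j, dirichletKernel L (x j) (y j) ∂cubeVol s =
      ∑ k : Fin s → Fin L → Bool, walshCoeff f k * walshProd k y := by
  have h (x : Fin s → ℝ) : f x * ∏ j, dirichletKernel L (x j) (y j) =
      ∑ k : Fin s → Fin L → Bool, f x * walshProd k x * walshProd k y := by
    simp only [dirichletKernel_eq_sum, Finset.prod_univ_sum, Fintype.piFinset_univ, walshProd,
      Finset.prod_mul_distrib, Finset.mul_sum, mul_assoc]
  simp only [h]
  rw [integral_finsetSum _ fun k _ => (integrable_cubeVol_continuousOn_mul hf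
    (measurable_walshProd k) fun x => (abs_walshProd k x).le).mul_const _]
  simp only [integral_mul_const, walshCoeff]

lemma integral_prod_dirichletKernel {s : ℕ} (L : ℕ) (y : Fin s → ℝ) :
    ∫ x, ∏ j, dirichletKernel L (x j) (y j) ∂cubeVol s = 1 := by
  rw [integral_fintype_prod_eq_prod (fun j t => dirichletKernel L t (y j))]
  simp [integral_dirichletKernel]

lemma measurable_prod_dirichletKernel {s : ℕ} (L : ℕ) (y : Fin s → ℝ) :
    Measurable fun x : Fin s → ℝ => ∏ j, dirichletKernel L (x j) (y j) :=
  Finset.measurable_prod _ fun j _ =>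
    (measurable_dirichletKernel L (y j)).comp (measurable_pi_apply j)

lemma integrable_mul_prod_dirichletKernel {s : ℕ} (L : ℕ) (y : Fin s → ℝ)
    {f : (Fin s → ℝ) → ℝ} (hf : ContinuousOn f (closedCube s)) :
    Integrable (fun x => f x * ∏ j, dirichletKernel L (x j) (y j)) (cubeVol s) := by
  refine integrable_cubeVol_continuousOn_mul (c := ∏ _j : Fin s, ∏ _i : Fin L, 2) hf
    (measurable_prod_dirichletKernel L y) fun x => ?_
  rw [Finset.abs_prod]
  refine Finset.prod_le_prod (fun _ _ => abs_nonneg _) fun j _ => ?_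
  rw [dirichletKernel, Finset.abs_prod]
  refine Finset.prod_le_prod (fun _ _ => abs_nonneg _) fun i _ => ?_
  rcases rademacher_eq_or i (x j) with h | h <;> rcases rademacher_eq_or i (y j) with h' | h' <;>
    norm_num [h, h']

/-- The dyadic local averages of a continuous function converge to its values. -/
lemma tendsto_integral_dirichletKernel {s : ℕ} {f : (Fin s → ℝ) → ℝ}
    (hf : ContinuousOn f (closedCube s)) {y : Fin s → ℝ} (hy : y ∈ halfOpenCube s) :
    Filter.Tendsto (fun L => ∫ x, f x * ∏ j, dirichletKernel L (x j) (y j) ∂cubeVol s)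
      Filter.atTop (nhds (f y)) := by
  rw [Metric.tendsto_atTop]
  intro ε hε
  obtain ⟨δ, hδ, hfδ⟩ := Metric.continuousOn_iff.1 hf y (halfOpenCube_subset s hy) (ε / 2)
    (half_pos hε)
  obtain ⟨M, hM⟩ := exists_pow_lt_of_lt_one hδ (by norm_num : (1 / 2 : ℝ) < 1)
  refine ⟨M, fun L hL => ?_⟩
  set K : (Fin s → ℝ) → ℝ := fun x => ∏ j, dirichletKernel L (x j) (y j) with hK
  have hK0 (x : Fin s → ℝ) : 0 ≤ K x := Finset.prod_nonneg fun j _ => dirichletKernel_nonneg _ _ _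
  have hKi : Integrable K (cubeVol s) := by
    simpa using integrable_mul_prod_dirichletKernel L y (f := fun _ => 1) continuousOn_const
  -- The kernel is supported on a dyadic box of side `(1 / 2) ^ L` containing `y`, where `f` varies
  -- by less than `ε / 2`.
  have hpt (x : Fin s → ℝ) (hx : x ∈ halfOpenCube s) : |(f x - f y) * K x| ≤ ε / 2 * K x := by
    rw [abs_mul, abs_of_nonneg (hK0 x)]
    by_cases h : K x = 0
    · simp [h]
    · refine mul_le_mul_of_nonneg_right (hfδ x (halfOpenCube_subset s hx) ?_).le (hK0 x)
      refine ((dist_pi_le_iff (by positivity)).2 fun j => ?_).trans_lt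
        ((pow_le_pow_of_le_one (by norm_num) (by norm_num) hL).trans_lt hM)
      rw [Real.dist_eq]
      exact abs_sub_le_of_dirichletKernel_ne_zero (mem_halfOpenCube.1 hx j)
        (mem_halfOpenCube.1 hy j) (Finset.prod_ne_zero_iff.1 h j (Finset.mem_univ j))
  have h1 : (∫ x, f x * K x ∂cubeVol s) - f y = ∫ x, (f x - f y) * K x ∂cubeVol s := by
    simp only [sub_mul]
    rw [integral_sub (integrable_mul_prod_dirichletKernel L y hf) (hKi.const_mul _),
      integral_const_mul, integral_prod_dirichletKernel, mul_one]
  rw [Real.dist_eq, h1]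
  calc _ ≤ ∫ x, ε / 2 * K x ∂cubeVol s := by
        rw [← Real.norm_eq_abs]
        exact norm_integral_le_of_norm_le (hKi.const_mul _) ((ae_mem_halfOpenCube s).mono hpt)
    _ = ε / 2 := by rw [integral_const_mul, integral_prod_dirichletKernel, mul_one]
    _ < ε := half_lt_self hε

/-! ### Digital nets as groups of digit arrays. -/

/-- The real number in `[0,1)` with given binary digits. -/
def digitValue {n : ℕ} (Y : Fin n → ZMod 2) : ℝ := ∑ i : Fin n, ((Y i).val : ℝ) / 2 ^ ((i : ℕ) + 1)

/-- The nontrivial character of the two-element field. -/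
def signChar (z : ZMod 2) : ℝ := if z = 0 then 1 else -1

lemma eq_zero_or_one_of_zmodTwo : ∀ z : ZMod 2, z = 0 ∨ z = 1 := by decide

lemma signChar_add (z w : ZMod 2) : signChar (z + w) = signChar z * signChar w := by
  rcases eq_zero_or_one_of_zmodTwo z with rfl | rfl <;>
    rcases eq_zero_or_one_of_zmodTwo w with rfl | rfl <;>
    simp [signChar, show (1 : ZMod 2) + 1 = 0 from rfl]

lemma signChar_injective : Function.Injective signChar := by
  intro z w h
  rcases eq_zero_or_one_of_zmodTwo z with rfl | rfl <;>
    rcases eq_zero_or_one_of_zmodTwo w with rfl | rfl <;>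
    simp [signChar] at h ⊢ <;> norm_num at h

lemma digitValue_succ {n : ℕ} (Y : Fin (n + 1) → ZMod 2) :
    digitValue Y = digitValue (Fin.tail Y) / 2 + ((Y 0).val : ℝ) / 2 := by
  simp only [digitValue, Fin.sum_univ_succ, Fin.val_zero, Fin.val_succ, Fin.tail, Finset.sum_div,
    zero_add, pow_one]
  rw [add_comm]
  congr 1
  refine Finset.sum_congr rfl fun i _ => ?_
  rw [div_div, ← pow_succ]

lemma digitValue_eq_half {n : ℕ} {Y : Fin (n + 1) → ZMod 2} (h : Y 0 = 0) :
    digitValue Y = digitValue (Fin.tail Y) / 2 := by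
  rw [digitValue_succ, h]
  simp

lemma digitValue_eq_half_add {n : ℕ} {Y : Fin (n + 1) → ZMod 2} (h : Y 0 = 1) :
    digitValue Y = digitValue (Fin.tail Y) / 2 + 1 / 2 := by
  rw [digitValue_succ, h, ZMod.val_one]
  simp

lemma digitValue_mem_Ico {n : ℕ} (Y : Fin n → ZMod 2) : digitValue Y ∈ Set.Ico (0 : ℝ) 1 := by
  induction n with
  | zero => simp [digitValue]
  | succ n ih =>
    have := ih (Fin.tail Y)
    rcases eq_zero_or_one_of_zmodTwo (Y 0) with h | h
    · rw [digitValue_eq_half h]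
      constructor <;> linarith [this.1, this.2]
    · rw [digitValue_eq_half_add h]
      constructor <;> linarith [this.1, this.2]

/-- A finite expansion is recovered exactly by the floor function; all digits from index `n` on are
zero and give the sign 1. -/
lemma rademacher_digitValue {n : ℕ} (Y : Fin n → ZMod 2) (i : ℕ) :
    rademacher i (digitValue Y) = if h : i < n then signChar (Y ⟨i, h⟩) else 1 := by
  induction n generalizing i with
  | zero => simp [digitValue, rademacher]
  | succ n ih =>
    have hm := digitValue_mem_Ico (Fin.tail Y)
    rcases eq_zero_or_one_of_zmodTwo (Y 0) with h | h
    · rw [digitValue_eq_half h]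
      cases i with
      | zero => simp [rademacher_zero_half hm, h, signChar]
      | succ i => simp [rademacher_succ_half, ih, Fin.tail]
    · rw [digitValue_eq_half_add h]
      cases i with
      | zero => rw [rademacher_zero_half_add hm]; simp [h, signChar]
      | succ i => rw [rademacher_succ_half_add, ih]; simp [Fin.tail]

lemma digitValue_injective {n : ℕ} : Function.Injective (digitValue (n := n)) := by
  intro Y Z h
  funext i
  apply signChar_injective
  have h1 := rademacher_digitValue Y i
  rw [h, rademacher_digitValue Z i] at h1
  simpa using h1.symm

lemma rademacher_digitValue_add {n : ℕ} (Y Z : Fin n → ZMod 2) (i : ℕ) :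
    rademacher i (digitValue (Y + Z)) =
      rademacher i (digitValue Y) * rademacher i (digitValue Z) := by
  simp only [rademacher_digitValue]
  split_ifs
  · rw [Pi.add_apply, signChar_add]
  · simp

lemma walsh_digitValue_add {n L : ℕ} (k : Fin L → Bool) (Y Z : Fin n → ZMod 2) :
    walsh k (digitValue (Y + Z)) = walsh k (digitValue Y) * walsh k (digitValue Z) := by
  rw [walsh, walsh, walsh, ← Finset.prod_mul_distrib]
  refine Finset.prod_congr rfl fun i _ => ?_
  rw [rademacher_digitValue_add]
  split_ifs <;> simp

/-- The point of the cube whose coordinates have the given binary digits. -/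
def digitPoint {s n : ℕ} (Y : Fin s → Fin n → ZMod 2) : Fin s → ℝ := fun j => digitValue (Y j)

lemma digitPoint_injective {s n : ℕ} : Function.Injective (digitPoint (s := s) (n := n)) :=
  fun _ _ h => funext fun j => digitValue_injective (congrFun h j)

lemma walshProd_digitPoint_add {s n L : ℕ} (k : Fin s → Fin L → Bool)
    (Y Z : Fin s → Fin n → ZMod 2) : walshProd k (digitPoint (Y + Z)) =
      walshProd k (digitPoint Y) * walshProd k (digitPoint Z) := by
  rw [walshProd, walshProd, walshProd, ← Finset.prod_mul_distrib]
  exact Finset.prod_congr rfl fun j _ => walsh_digitValue_add _ _ _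

/-- A character sum over a finite set of digit arrays that is closed under addition. -/
lemma sum_walshProd_nonneg {s n L : ℕ} {H : Finset (Fin s → Fin n → ZMod 2)}
    (hH : ∀ Y ∈ H, ∀ Z ∈ H, Y + Z ∈ H) (k : Fin s → Fin L → Bool) :
    0 ≤ ∑ Y ∈ H, walshProd k (digitPoint Y) := by
  have hadd (Y Z : Fin s → Fin n → ZMod 2) : Y + Z + Z = Y := by
    funext j i
    simp only [Pi.add_apply, add_assoc, CharTwo.add_self_eq_zero, add_zero]
  by_cases h : ∃ Z ∈ H, walshProd k (digitPoint Z) = -1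
  · obtain ⟨Z, hZ, hZ1⟩ := h
    -- Translation by an element of character value -1 permutes `H` and changes the sign of the sum,
    -- so the sum vanishes.
    have hs : ∑ Y ∈ H, walshProd k (digitPoint Y) = ∑ Y ∈ H, -walshProd k (digitPoint Y) :=
      Finset.sum_nbij' (· + Z) (· + Z) (fun Y hY => hH Y hY Z hZ) (fun Y hY => hH Y hY Z hZ)
        (fun Y _ => hadd Y Z) (fun Y _ => hadd Y Z) fun Y _ => by
          rw [walshProd_digitPoint_add, hZ1]; ring
    rw [Finset.sum_neg_distrib] at hs
    linarith
  · refine Finset.sum_nonneg fun Y hY => ?_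
    rcases eq_or_eq_neg_of_abs_eq (abs_walshProd k (digitPoint Y)) with h1 | h1
    · rw [h1]; exact zero_le_one
    · exact absurd ⟨Y, hY, h1⟩ h

lemma digitVector_xor (m h h' : ℕ) :
    digitVector m (h ^^^ h') = digitVector m h + digitVector m h' := by
  funext i
  simp only [digitVector, Nat.testBit_xor, Pi.add_apply]
  cases h.testBit i <;> cases h'.testBit i <;> simp [show (1 : ZMod 2) + 1 = 0 from rfl]

lemma IsDigitalNet.exists_eq_image {s : ℕ} {P : Finset (Fin s → ℝ)} (hP : IsDigitalNet P) :
    ∃ (n : ℕ) (H : Finset (Fin s → Fin n → ZMod 2)), H.Nonempty ∧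
      (∀ Y ∈ H, ∀ Z ∈ H, Y + Z ∈ H) ∧ P = H.image digitPoint := by
  obtain ⟨n, m, C, -, -, hPC⟩ := hP
  -- Different `h` may give the same array. Passing to the image set matches the definition of `P`
  -- as a set, and keeps closure under addition.
  refine ⟨n, (Finset.range (2 ^ m)).image fun h j => (C j).mulVec (digitVector m h),
    ⟨_, Finset.mem_image_of_mem _ (Finset.mem_range.2 (Nat.two_pow_pos m))⟩, ?_, ?_⟩
  · simp only [Finset.mem_image, Finset.mem_range]
    rintro _ ⟨h, hh, rfl⟩ _ ⟨h', hh', rfl⟩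
    -- Bitwise exclusive or of the indices is addition of digit vectors over the two-element field.
    refine ⟨h ^^^ h', Nat.xor_lt_two_pow hh hh', ?_⟩
    funext j
    rw [digitVector_xor, Matrix.mulVec_add, Pi.add_apply]
  · ext x
    rw [← Finset.mem_coe, hPC]
    simp only [Set.mem_ofPred_eq, Finset.mem_image, Finset.mem_range, exists_exists_and_eq_and]
    exact ⟨fun ⟨h, hh, hx⟩ => ⟨h, hh, hx.symm⟩, fun ⟨h, hh, hx⟩ => ⟨h, hh, hx.symm⟩⟩

lemma IsDigitalNet.nonempty {s : ℕ} {P : Finset (Fin s → ℝ)} (hP : IsDigitalNet P) :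
    P.Nonempty := by
  obtain ⟨n, H, hH, -, rfl⟩ := hP.exists_eq_image
  exact hH.image _

lemma IsDigitalNet.mem_halfOpenCube {s : ℕ} {P : Finset (Fin s → ℝ)} (hP : IsDigitalNet P)
    {x : Fin s → ℝ} (hx : x ∈ P) : x ∈ halfOpenCube s := by
  obtain ⟨n, H, -, -, rfl⟩ := hP.exists_eq_image
  obtain ⟨Y, -, rfl⟩ := Finset.mem_image.1 hx
  exact QMC.mem_halfOpenCube.2 fun j => digitValue_mem_Ico (Y j)

lemma IsDigitalNet.quadrature_walshProd_nonneg {s L : ℕ} {P : Finset (Fin s → ℝ)}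
    (hP : IsDigitalNet P) (k : Fin s → Fin L → Bool) : 0 ≤ quadrature P (walshProd k) := by
  obtain ⟨n, H, -, hH, rfl⟩ := hP.exists_eq_image
  rw [quadrature, Finset.sum_image fun _ _ _ _ h => digitPoint_injective h]
  exact mul_nonneg (by positivity) (sum_walshProd_nonneg hH k)

lemma IsDigitalNet.exists_rademacher_eq_one {s : ℕ} {P : Finset (Fin s → ℝ)}
    (hP : IsDigitalNet P) : ∃ n, ∀ x ∈ P, ∀ j, rademacher n (x j) = 1 := by
  obtain ⟨n, H, -, -, rfl⟩ := hP.exists_eq_image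
  -- Digits are indexed from 0, so index `n` is the first one beyond the available digits.
  refine ⟨n, fun x hx j => ?_⟩
  obtain ⟨Y, -, rfl⟩ := Finset.mem_image.1 hx
  simp [digitPoint, rademacher_digitValue]

/-! ### The error as a nonnegative combination of Walsh coefficients, and the conclusion. -/

/-- The quadrature error of the dyadic local averages of depth `L` of a function. -/
def dyadicErr {s : ℕ} (L : ℕ) (f : (Fin s → ℝ) → ℝ) (P : Finset (Fin s → ℝ)) : ℝ :=
  quadrature P (fun y => ∫ x, f x * ∏ j, dirichletKernel L (x j) (y j) ∂cubeVol s) - integral f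

lemma tendsto_dyadicErr {s : ℕ} {f : (Fin s → ℝ) → ℝ} (hf : ContinuousOn f (closedCube s))
    {P : Finset (Fin s → ℝ)} (hP : IsDigitalNet P) :
    Filter.Tendsto (fun L => dyadicErr L f P) Filter.atTop (nhds (err f P)) :=
  ((tendsto_finsetSum _ fun _ hy =>
    tendsto_integral_dirichletKernel hf (hP.mem_halfOpenCube hy)).const_mul _).sub_const _

/-- The digit array of the constant Walsh function. -/
def zeroDigits (s L : ℕ) : Fin s → Fin L → Bool := fun _ _ => false

lemma walshProd_zeroDigits {s L : ℕ} (x : Fin s → ℝ) : walshProd (zeroDigits s L) x = 1 := by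
  simp [walshProd, walsh, zeroDigits]

/-- The constant Walsh function is integrated exactly and its coefficient is the integral of `f`, so
precisely that term cancels. -/
lemma dyadicErr_eq_sum {s : ℕ} (L : ℕ) {f : (Fin s → ℝ) → ℝ}
    (hf : ContinuousOn f (closedCube s)) {P : Finset (Fin s → ℝ)} (hP : P.Nonempty) :
    dyadicErr L f P = ∑ k ∈ Finset.univ.erase (zeroDigits s L),
      quadrature P (walshProd k) * walshCoeff f k := by
  have hc : (P.card : ℝ) ≠ 0 := Nat.cast_ne_zero.2 hP.card_pos.ne'
  have h1 : quadrature P (walshProd (zeroDigits s L)) * walshCoeff f (zeroDigits s L) =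
      integral f := by
    simp [quadrature, walshCoeff, walshProd_zeroDigits, integral_eq_cubeVol, hc]
  rw [dyadicErr, sub_eq_iff_eq_add', ← h1]
  refine Eq.trans ?_ (Finset.add_sum_erase Finset.univ
    (fun k => quadrature P (walshProd k) * walshCoeff f k) (Finset.mem_univ _)).symm
  simp only [quadrature, sum_integral_dirichletKernel hf]
  rw [Finset.sum_comm, Finset.mul_sum]
  refine Finset.sum_congr rfl fun k _ => ?_
  rw [← Finset.mul_sum]
  ring

lemma abs_err_le {s : ℕ} {u : Fin s → ℝ} (hu : ∀ j, 0 < u j) {P : Finset (Fin s → ℝ)}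
    (hP : IsDigitalNet P) {f : (Fin s → ℝ) → ℝ} (hf : f ∈ weightedSpace u)
    (hf1 : weightedNorm u f ≤ 1) :
    |err f P| ≤ 2 ^ s * (constB u)⁻¹ * err (expFun u) P := by
  have hg : ContinuousOn (expFun u) (closedCube s) := (contDiff_expFun u).continuous.continuousOn
  refine le_of_tendsto_of_tendsto (tendsto_dyadicErr hf.1.continuousOn hP).abs
    ((tendsto_dyadicErr hg hP).const_mul _) ?_
  -- Depth at least 1 is required because the infimum in `B` runs over `w ≥ 1`.
  filter_upwards [Filter.eventually_ge_atTop 1] with L hL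
  rw [dyadicErr_eq_sum L hf.1.continuousOn hP.nonempty, dyadicErr_eq_sum L hg hP.nonempty,
    Finset.mul_sum]
  refine (Finset.abs_sum_le_sum_abs _ _).trans (Finset.sum_le_sum fun k _ => ?_)
  rw [abs_mul, abs_of_nonneg (hP.quadrature_walshProd_nonneg k), mul_left_comm]
  exact mul_le_mul_of_nonneg_left (abs_walshCoeff_le_expFun hL hu hf hf1 k)
    (hP.quadrature_walshProd_nonneg k)

lemma walshCoeff_expFun_pos {s L : ℕ} (hL : 1 ≤ L) {u : Fin s → ℝ} (hu : ∀ j, 0 < u j)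
    (k : Fin s → Fin L → Bool) : 0 < walshCoeff (expFun u) k :=
  (mul_pos (constB_pos hu) (Finset.prod_pos fun j _ =>
    mul_pos (pow_pos (hu j) _) (digitWeight_pos _))).trans_le
    (constB_mul_le_walshCoeff_expFun hL hu k)

/-- The digit array with a single nonzero digit. -/
def singleDigit {s : ℕ} (j₀ : Fin s) (n L : ℕ) : Fin s → Fin L → Bool :=
  fun j i => decide (j = j₀ ∧ (i : ℕ) = n)

lemma walshProd_singleDigit {s : ℕ} (j₀ : Fin s) {n L : ℕ} (hn : n < L) (x : Fin s → ℝ) :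
    walshProd (singleDigit j₀ n L) x = rademacher n (x j₀) := by
  rw [walshProd, Finset.prod_eq_single j₀, walsh, Finset.prod_eq_single ⟨n, hn⟩]
  · simp [singleDigit]
  · intro i _ hi
    have : (i : ℕ) ≠ n := fun h => hi (Fin.ext h)
    simp [singleDigit, this]
  · simp
  · intro j _ hj
    simp [singleDigit, walsh, hj]
  · simp

lemma singleDigit_ne_zeroDigits {s : ℕ} (j₀ : Fin s) {n L : ℕ} (hn : n < L) :
    singleDigit j₀ n L ≠ zeroDigits s L := fun h => by
  have := congrFun (congrFun h j₀) ⟨n, hn⟩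
  simp [singleDigit, zeroDigits] at this

/-- All terms of the Walsh sum are nonnegative, and the one with a single digit beyond the precision
of the net has weight 1. Its coefficient is positive and independent of `L`, so strict positivity
survives the limit. -/
lemma err_expFun_pos {s : ℕ} (hs : 1 ≤ s) {u : Fin s → ℝ} (hu : ∀ j, 0 < u j)
    {P : Finset (Fin s → ℝ)} (hP : IsDigitalNet P) : 0 < err (expFun u) P := by
  have hg : ContinuousOn (expFun u) (closedCube s) := (contDiff_expFun u).continuous.continuousOn
  obtain ⟨n, hn⟩ := hP.exists_rademacher_eq_one
  let j₀ : Fin s := ⟨0, hs⟩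
  have hc : (P.card : ℝ) ≠ 0 := Nat.cast_ne_zero.2 hP.nonempty.card_pos.ne'
  have hcoeff {L : ℕ} (hL : n < L) : walshCoeff (expFun u) (singleDigit j₀ n L) =
      ∫ x, expFun u x * rademacher n (x j₀) ∂cubeVol s := by
    simp only [walshCoeff, walshProd_singleDigit j₀ hL]
  have hpos : 0 < ∫ x, expFun u x * rademacher n (x j₀) ∂cubeVol s := by
    rw [← hcoeff n.lt_succ_self]
    exact walshCoeff_expFun_pos (Nat.succ_pos n) hu _
  refine hpos.trans_le (ge_of_tendsto (tendsto_dyadicErr hg hP) ?_)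
  filter_upwards [Filter.eventually_gt_atTop n] with L hL
  have hq : quadrature P (walshProd (singleDigit j₀ n L)) = 1 := by
    rw [quadrature, Finset.sum_congr rfl fun x hx => by
      rw [walshProd_singleDigit j₀ hL, hn x hx]]
    simp [hc]
  rw [dyadicErr_eq_sum L hg hP.nonempty, ← hcoeff hL, ← one_mul (walshCoeff _ _), ← hq]
  exact Finset.single_le_sum (f := fun k => quadrature P (walshProd k) * walshCoeff (expFun u) k)
    (fun k _ => mul_nonneg (hP.quadrature_walshProd_nonneg k)
      (walshCoeff_expFun_pos (Nat.one_le_of_lt hL) hu k).le)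
    (Finset.mem_erase.2 ⟨singleDigit_ne_zeroDigits j₀ hL, Finset.mem_univ _⟩)

lemma err_normalizedExpFun {s : ℕ} {u : Fin s → ℝ} (hu : ∀ j, 0 < u j)
    (P : Finset (Fin s → ℝ)) :
    err (normalizedExpFun u) P = (constA u)⁻¹ * err (expFun u) P := by
  rw [← err_const_mul]
  congr 1
  funext x
  rw [normalizedExpFun, weightedNorm_expFun hu, div_eq_inv_mul]

/-- The test function is the exponential divided by `A`, which has norm exactly 1. -/
lemma le_worstCaseError {s : ℕ} {u : Fin s → ℝ} (hu : ∀ j, 0 < u j) (P : Finset (Fin s → ℝ)) :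
    (((constA u)⁻¹ * err (expFun u) P : ℝ) : EReal) ≤ worstCaseError P u := by
  have hA := constA_pos hu
  refine le_trans (EReal.coe_le_coe_iff.2 (le_abs_self _)) (le_sSup
    ⟨_, const_mul_expFun_mem hu (constA u)⁻¹, ?_, by rw [err_const_mul]⟩)
  rw [weightedNorm_const_mul_expFun hu, abs_of_pos (inv_pos.2 hA), inv_mul_cancel₀ hA.ne']

lemma worstCaseError_le {s : ℕ} {u : Fin s → ℝ} (hu : ∀ j, 0 < u j) {P : Finset (Fin s → ℝ)}
    (hP : IsDigitalNet P) :
    worstCaseError P u ≤ ((2 ^ s * (constB u)⁻¹ * err (expFun u) P : ℝ) : EReal) := by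
  refine sSup_le ?_
  rintro _ ⟨f, hf, hf1, rfl⟩
  exact EReal.coe_le_coe_iff.2 (abs_err_le hu hP hf hf1)

end QMC

end

theorem mainTheorem1 (s : ℕ) (hs : 1 ≤ s) (u : Fin s → ℝ) (hu : ∀ j, 0 < u j) :
    0 < QMC.constB u ∧
    QMC.expFun u ∈ QMC.weightedSpace u ∧
    0 < QMC.weightedNorm u (QMC.expFun u) ∧
    ∀ P : Finset (Fin s → ℝ), QMC.IsDigitalNet P →
      ((((QMC.constA u)⁻¹ * QMC.err (QMC.expFun u) P : ℝ) : EReal) ≤ QMC.worstCaseError P u ∧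
        QMC.worstCaseError P u ≤
          ((2 ^ s * (QMC.constB u)⁻¹ * QMC.err (QMC.expFun u) P : ℝ) : EReal)) ∧
      (((QMC.err (QMC.normalizedExpFun u) P : ℝ) : EReal) ≤ QMC.worstCaseError P u ∧
        QMC.worstCaseError P u ≤
          ((2 ^ s * QMC.constA u / QMC.constB u * QMC.err (QMC.normalizedExpFun u) P : ℝ) :
            EReal)) ∧
      0 < QMC.err (QMC.expFun u) P := by
  have hA := QMC.constA_pos hu
  refine ⟨QMC.constB_pos hu, QMC.expFun_mem hu, (QMC.weightedNorm_expFun hu).symm ▸ hA,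
    fun P hP => ⟨⟨QMC.le_worstCaseError hu P, QMC.worstCaseError_le hu hP⟩, ?_,
      QMC.err_expFun_pos hs hu hP⟩⟩
  have h : 2 ^ s * QMC.constA u / QMC.constB u * ((QMC.constA u)⁻¹ * QMC.err (QMC.expFun u) P) =
      2 ^ s * (QMC.constB u)⁻¹ * QMC.err (QMC.expFun u) P := by
    field_simp
  rw [QMC.err_normalizedExpFun hu, h]
  exact ⟨QMC.le_worstCaseError hu P, QMC.worstCaseError_le hu hP⟩
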